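/- Fix $\lambda>0$, $\theta\in[-1,1]$, real numbers $a_1,\dots,a_N<1$, and $p_1,\dots,p_N\ge 0$ with $\sum_i p_i=1$; write $\bar a_i=1-a_i$. Let $(\Omega_n,S_n,J_n)$, $n\ge 0$, be i.i.d. triples such that $\Omega_n$ is independent of $(S_n,J_n)$ with law $\sum_i p_i\delta_{a_i}$, $S_n$ has a density $f_S$ on $(0,\infty)$ with distribution function $F_S$ and finite mean, $J_n\sim\exp(\lambda)$ with distribution function $F_J$, and $(S_n,J_n)$ is dependent through the Farlie–Gumbel–Morgenstern copula: $$P(S_n\le x,\,J_n\le y)=C_\theta(F_S(x),F_J(y)),\qquad C_\theta(u,v)=uv+\theta uv(1-u)(1-v).$$ Consider the single-server first-come-first-served queue with service times $S_n$ and interarrival times $A_n=\Omega_nS_n+J_n$. The waiting times are $W_{n+1}=[W_n+S_n-A_n]^+$, with $W_0\ge 0$ independent of the triples. Put $$M_n=W_n+[S_n-A_n]^+,\qquad V_n=\min\bigl(W_n,[W_n+S_n-A_n]^+\bigr).$$ Assume the stability condition $\rho:=\lambda\sum_i p_i\bar a_iE(S)<1$. Write $\phi_S(s)=E(e^{-sS})$,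 $g(x)=f_S(x)(1-2F_S(x))$ and $g^*(s)=\int_0^\infty e^{-sx}g(x)\,dx$. (0) If $a_i\ge 0$ for all $i$ (so that $A_n\ge 0$), then almost surely, for all $n\ge 1$, $M_n$ is the maximum overlap time of customer $n$, i.e. the greatest length of the intersection of its sojourn interval with that of another customer, and $V_n$ is the smaller of its overlap times with customers $n-1$ and $n+1$. (1) $W_n,M_n,V_n$ converge in distribution to nonnegative (proper) limits $W_\infty,M_\infty,V_\infty$. The transform $w^*(s)=E(e^{-sW_\infty})$ satisfies, for all $s\in\mathbb C$ with $\mathrm{Re}\,s\ge 0$, $s\notin\{\lambda,2\lambda\}$, $$w^*(s)\,K(s)=s\sum_{i=1}^Np_i\left(\frac{\theta g^*(\bar a_i\lambda)-\phi_S(\bar a_i\lambda)}{\lambda-s}w^*(\lambda)-\frac{\theta g^*(2\bar a_i\lambda)}{2\lambda-s}w^*(2\lambda)\right),$$ $$K(s)=1-\sum_{i=1}^Np_i\left(\frac{\lambda}{\lambda-s}\phi_S(\bar a_is)-\theta\frac{s\lambda}{(\lambda-s)(2\lambda-s)}g^*(\bar a_is)\right).$$ (2) $w^*(0)=1$, and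 $(x,y)=(w^*(\lambda),w^*(2\lambda))$ satisfies $$\sum_{i=1}^Np_i\Bigl(2\bigl(\theta g^*(\bar a_i\lambda)-\phi_S(\bar a_i\lambda)\bigr)x-\theta g^*(2\bar a_i\lambda)\,y\Bigr)=-2(1-\rho).\tag{a}$$ If $\theta\ne 0$, the zeros of $K$ in $\{\mathrm{Re}\,s\ge0\}\setminus\{\lambda,2\lambda\}$ are exactly $\tau_2=0$ and one point $\tau_1$ with $\mathrm{Re}\,\tau_1>0$. Moreover, (a) together with the linear equation in $x,y$ saying that the right-hand side of the functional equation, with $x,y$ in place of $w^*(\lambda),w^*(2\lambda)$, vanishes at $s=\tau_1$ has $(w^*(\lambda),w^*(2\lambda))$ as its unique complex solution. If $\theta=0$, the unknown $w^*(2\lambda)$ drops out, the only such zero of $K$ is $0$, and (a) alone determines $w^*(\lambda)$. (3) For $\mathrm{Re}\,s\ge 0$, $s\notin\{\lambda,2\lambda\}$, $$E(e^{-sM_\infty})=w^*(s)\sum_{i=1}^Np_i\left(\frac{\lambda}{\lambda-s}\phi_S(\bar a_is)-\frac{s}{\lambda-s}\phi_S(\bar a_i\lambda)+s\theta\left[\frac{g^*(\bar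 a_i\lambda)}{\lambda-s}-\frac{g^*(2\bar a_i\lambda)}{2\lambda-s}-\frac{\lambda\,g^*(\bar a_is)}{(2\lambda-s)(\lambda-s)}\right]\right),$$ $$E(e^{-sV_\infty})=w^*(s)\left(2+\sum_{i=1}^Np_i\left[\frac{s}{\lambda-s}\phi_S(\bar a_i\lambda)-\frac{\lambda}{\lambda-s}\phi_S(\bar a_is)+\theta s\left(\frac{\lambda\,g^*(\bar a_is)}{(2\lambda-s)(\lambda-s)}+\frac{g^*(2\bar a_i\lambda)}{2\lambda-s}-\frac{g^*(\bar a_i\lambda)}{\lambda-s}\right)\right]\right).$$ -/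

import Mathlib

open MeasureTheory ProbabilityTheory Filter

namespace FGMQueue

noncomputable section

/-- The Farlie-Gumbel-Morgenstern copula with parameter `θ`. -/
def fgmCopula (θ u v : ℝ) : ℝ := u * v + θ * u * v * (1 - u) * (1 - v)

/-- The law on `(0, ∞)` with density `f`. -/
def lawOfDensity (f : ℝ → ℝ) : Measure ℝ :=
  (volume.restrict (Set.Ioi 0)).withDensity (fun x => ENNReal.ofReal (f x))

/-- The Laplace-Stieltjes transform `E (e ^ (-s X))` of a law on `[0, ∞)`. -/
def lst (μ : Measure ℝ) (s : ℂ) : ℂ := ∫ x, Complex.exp (-s * (x : ℂ)) ∂μ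

/-- `φ_S(s)`, the transform of the law with density `f`. -/
def phi (f : ℝ → ℝ) (s : ℂ) : ℂ := lst (lawOfDensity f) s

/-- `g(x) = f(x) (1 - 2 F(x))`, where `F` is the distribution function with density `f`. -/
def gFun (f : ℝ → ℝ) (x : ℝ) : ℝ := f x * (1 - 2 * cdf (lawOfDensity f) x)

/-- `g*(s)`, the Laplace transform of `g`. -/
def gStar (f : ℝ → ℝ) (s : ℂ) : ℂ :=
  ∫ x in Set.Ioi (0 : ℝ), Complex.exp (-s * (x : ℂ)) * ((gFun f x : ℝ) : ℂ)

/-- Interarrival times `A_n = Ω_n S_n + J_n` (time between the arrivals of customers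
`n` and `n + 1`). -/
def interarrival {Ω : Type*} (Om S J : ℕ → Ω → ℝ) (n : ℕ) (ω : Ω) : ℝ :=
  Om n ω * S n ω + J n ω

/-- Waiting times in the single-server first-come-first-served queue: the first customer finds
the workload `W0`, and `W_{n+1} = [W_n + S_n - A_n]⁺`. -/
def waiting {Ω : Type*} (W0 : Ω → ℝ) (S A : ℕ → Ω → ℝ) : ℕ → Ω → ℝ
  | 0 => W0
  | n + 1 => fun ω => max (waiting W0 S A n ω + S n ω - A n ω) 0

/-- Arrival epoch of customer `n`; customer `0` arrives at time `0`. -/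
def arrival {Ω : Type*} (A : ℕ → Ω → ℝ) (n : ℕ) (ω : Ω) : ℝ := ∑ k ∈ Finset.range n, A k ω

/-- Departure epoch of customer `n`. -/
def departure {Ω : Type*} (W0 : Ω → ℝ) (S A : ℕ → Ω → ℝ) (n : ℕ) (ω : Ω) : ℝ :=
  arrival A n ω + waiting W0 S A n ω + S n ω

/-- Overlap time of the customers `m` and `n`: the length of the intersection of their sojourn
intervals. -/
def overlap {Ω : Type*} (W0 : Ω → ℝ) (S A : ℕ → Ω → ℝ) (m n : ℕ) (ω : Ω) : ℝ :=
  max (min (departure W0 S A m ω) (departure W0 S A n ω)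
    - max (arrival A m ω) (arrival A n ω)) 0

/-- `M_n = W_n + [S_n - A_n]⁺`. -/
def maxOverlap {Ω : Type*} (W0 : Ω → ℝ) (S A : ℕ → Ω → ℝ) (n : ℕ) (ω : Ω) : ℝ :=
  waiting W0 S A n ω + max (S n ω - A n ω) 0

/-- `V_n = min (W_n, [W_n + S_n - A_n]⁺)`. -/
def minOverlap {Ω : Type*} (W0 : Ω → ℝ) (S A : ℕ → Ω → ℝ) (n : ℕ) (ω : Ω) : ℝ :=
  min (waiting W0 S A n ω) (max (waiting W0 S A n ω + S n ω - A n ω) 0)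

variable {N : ℕ}

/-- The factor of `w*(s)` on the left of the functional equation. -/
def bracket (lam θ : ℝ) (a p : Fin N → ℝ) (f : ℝ → ℝ) (s : ℂ) : ℂ :=
  1 - ∑ i, (p i : ℂ) *
    ((lam : ℂ) / (lam - s) * phi f ((1 - a i) * s)
      - θ * (s * lam / ((lam - s) * (2 * lam - s))) * gStar f ((1 - a i) * s))

/-- The right-hand side of the functional equation, where `x` and `y` stand for the unknowns
`w*(λ)` and `w*(2λ)`. -/
def rhs (lam θ : ℝ) (a p : Fin N → ℝ) (f : ℝ → ℝ) (x y s : ℂ) : ℂ :=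
  s * ∑ i, (p i : ℂ) *
    ((θ * gStar f ((1 - a i) * lam) - phi f ((1 - a i) * lam)) / (lam - s) * x
      - θ * gStar f (2 * (1 - a i) * lam) / (2 * lam - s) * y)

/-- The linear form in `x = w*(λ)` and `y = w*(2λ)` to which `w*(0) = 1` gives the value
`-2 (1 - ρ)`. -/
def zeroForm (lam θ : ℝ) (a p : Fin N → ℝ) (f : ℝ → ℝ) (x y : ℂ) : ℂ :=
  ∑ i, (p i : ℂ) *
    (2 * (θ * gStar f ((1 - a i) * lam) - phi f ((1 - a i) * lam)) * x
      - θ * gStar f (2 * (1 - a i) * lam) * y)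

/-- The load `ρ = λ ∑ p_i (1 - a_i) E(S)`. -/
def load (lam : ℝ) (a p : Fin N → ℝ) (f : ℝ → ℝ) : ℝ :=
  lam * ∑ i, p i * (1 - a i) * ∫ x in Set.Ioi (0 : ℝ), x * f x

/-- The second factor of the transform of the maximum overlap time. -/
def maxFactor (lam θ : ℝ) (a p : Fin N → ℝ) (f : ℝ → ℝ) (s : ℂ) : ℂ :=
  ∑ i, (p i : ℂ) *
    ((lam : ℂ) / (lam - s) * phi f ((1 - a i) * s)
      - s / (lam - s) * phi f ((1 - a i) * lam)
      + s * θ * (gStar f ((1 - a i) * lam) / (lam - s)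
        - gStar f (2 * (1 - a i) * lam) / (2 * lam - s)
        - lam / ((2 * lam - s) * (lam - s)) * gStar f ((1 - a i) * s)))

/-- The second factor of the transform of the minimum overlap time. -/
def minFactor (lam θ : ℝ) (a p : Fin N → ℝ) (f : ℝ → ℝ) (s : ℂ) : ℂ :=
  2 + ∑ i, (p i : ℂ) *
    (phi f ((1 - a i) * lam) * (s / (lam - s))
      - (lam : ℂ) / (lam - s) * phi f ((1 - a i) * s)
      + θ * s * (lam / ((2 * lam - s) * (lam - s)) * gStar f ((1 - a i) * s)
        + gStar f (2 * (1 - a i) * lam) / (2 * lam - s)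
        - gStar f ((1 - a i) * lam) / (lam - s)))

end

end FGMQueue

/-! The FGM law of `(S, J)` has density `1 + θ (1 - 2 F_S) (1 - 2 F_J)` with respect to the product
of its marginals. For exponential `J`, the density of `J` times `1 - 2 F_J` is the exponential
density of rate `2λ` minus that of rate `λ`. Hence the transform of `[w + S - A]⁺` for fixed `w ≥ 0`
is an explicit combination of `e^{-sw}`, `e^{-λw}` and `e^{-2λw}` (`integral_coupled_cexp_max`,
`integral_increment_cexp_max`).

The waiting times form a Lindley recursion with i.i.d. increments of mean `(ρ - 1)/λ < 0`. Reversing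
the increments preserves the law of each `W_n` and turns it into a maximum of partial sums, which
converges almost surely by the law of large numbers. The limit law, taken jointly with an
independent increment, is invariant under the recursion (`exists_stationary_lindley`). Integrating
the one-step transform against it gives the functional equation, and division by `s → 0+` gives
equation (a).

No contour argument is needed for the zeros of `K`. At a nonzero zero the right-hand side vanishes;
cleared of denominators and of the factor `s`, it is the affine function `(2λ - s) α x - (λ - s) β
y`, with `α = ∑ p_i (θ g*(ā_i λ) - φ_S(ā_i λ))` and `β = θ ∑ p_i g*(2 ā_i λ)`. Two distinct roots
would force `αx = βy = 0`, against `2αx - βy = -2(1 - ρ) ≠ 0` (`kernel_zeros`). For `θ ≠ 0` a root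
exists on the positive real axis by the intermediate value theorem, thanks to `g* > 0` and `θ g* <
φ_S` there (`gReal_pos`, `theta_mul_gReal_lt_phiReal`). The same signs make the linear system for
the two unknowns nonsingular.

Finally `M = W + X⁺` is a sum of independent terms, and `{V, M} = {W, [W + X]⁺}` as unordered pairs,
so stationarity gives `E e^{-sV} + E e^{-sM} = 2 w*(s)`. -/

namespace FGMQueue

/-! ### The FGM coupling as a density with respect to the product law -/

lemma abs_one_sub_two_cdf_le (μ : Measure ℝ) (x : ℝ) : |1 - 2 * cdf μ x| ≤ 1 := by
  have h0 := cdf_nonneg μ x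
  have h1 := cdf_le_one μ x
  rw [abs_le]; constructor <;> linarith

lemma measurable_cdf (μ : Measure ℝ) : Measurable (fun x => cdf μ x) :=
  (monotone_cdf μ).measurable

lemma integrable_cdf (μ ρ : Measure ℝ) [IsFiniteMeasure ρ] :
    Integrable (fun x => cdf μ x) ρ := by
  refine Integrable.of_bound (measurable_cdf μ).aestronglyMeasurable 1 (ae_of_all _ fun x => ?_)
  rw [Real.norm_eq_abs, abs_le]
  constructor <;> linarith [cdf_nonneg μ x, cdf_le_one μ x]

/-- This is `∫ F dF = F²/2` for an atomless law: under `ρ × ρ` the events `u ≤ t` and `t ≤ u` have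
equal mass by symmetry, and ties are null. -/
lemma integral_measureReal_Iic (ρ : Measure ℝ) [IsFiniteMeasure ρ] [NullSingletonClass ρ] :
    2 * ∫ t, ρ.real (Set.Iic t) ∂ρ = ρ.real Set.univ ^ 2 := by
  have hI : ∀ t, ρ.real (Set.Iic t) = ∫ u, (Set.Iic t).indicator (fun _ => (1 : ℝ)) u ∂ρ := by
    intro t; rw [integral_indicator_const _ measurableSet_Iic]; simp
  have hJ : ∀ t, ρ.real (Set.Ici t) = ∫ u, (Set.Iic u).indicator (fun _ => (1 : ℝ)) t ∂ρ := by
    intro t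
    have : ∀ u, (Set.Iic u).indicator (fun _ => (1 : ℝ)) t
        = (Set.Ici t).indicator (fun _ => (1 : ℝ)) u := by
      intro u; simp [Set.indicator_apply]
    simp_rw [this]
    rw [integral_indicator_const _ measurableSet_Ici]; simp
  have hmeas : Measurable (fun q : ℝ × ℝ => (Set.Iic q.1).indicator (fun _ => (1 : ℝ)) q.2) := by
    have : (fun q : ℝ × ℝ => (Set.Iic q.1).indicator (fun _ => (1 : ℝ)) q.2)
        = Set.indicator {q : ℝ × ℝ | q.2 ≤ q.1} (fun _ => 1) := by
      ext q; simp [Set.indicator_apply]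
    rw [this]
    exact measurable_const.indicator (measurableSet_le measurable_snd measurable_fst)
  have hint : Integrable (fun q : ℝ × ℝ => (Set.Iic q.1).indicator (fun _ => (1 : ℝ)) q.2)
      (ρ.prod ρ) := by
    refine Integrable.of_bound hmeas.aestronglyMeasurable 1 (ae_of_all _ fun q => ?_)
    by_cases h : q.2 ≤ q.1 <;> simp [h]
  have hswap : ∫ t, ρ.real (Set.Ici t) ∂ρ = ∫ t, ρ.real (Set.Iic t) ∂ρ := by
    simp_rw [hI, hJ]
    exact (integral_integral_swap hint).symm
  have hanti : Antitone (fun t => ρ.real (Set.Ici t)) := fun s t h =>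
    measureReal_mono (Set.Ici_subset_Ici.2 h)
  have hmono : Monotone (fun t => ρ.real (Set.Iic t)) := fun s t h =>
    measureReal_mono (Set.Iic_subset_Iic.2 h)
  have hb : ∀ s : Set ℝ, ‖ρ.real s‖ ≤ ρ.real Set.univ := fun s => by
    rw [Real.norm_of_nonneg measureReal_nonneg]; exact measureReal_mono (Set.subset_univ s)
  have h1 : Integrable (fun t => ρ.real (Set.Ici t)) ρ :=
    Integrable.of_bound hanti.measurable.aestronglyMeasurable _ (ae_of_all _ fun t => hb _)
  have h2 : Integrable (fun t => ρ.real (Set.Iic t)) ρ :=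
    Integrable.of_bound hmono.measurable.aestronglyMeasurable _ (ae_of_all _ fun t => hb _)
  have hsum : ∀ t, ρ.real (Set.Iic t) + ρ.real (Set.Ici t) = ρ.real Set.univ := by
    intro t
    have : ρ.real (Set.Ici t) = ρ.real (Set.Iic t)ᶜ := by
      rw [Set.compl_Iic]; simp only [measureReal_def]; rw [measure_congr Ioi_ae_eq_Ici.symm]
    rw [this]; exact measureReal_add_measureReal_compl measurableSet_Iic
  calc 2 * ∫ t, ρ.real (Set.Iic t) ∂ρ
      = ∫ t, ρ.real (Set.Iic t) ∂ρ + ∫ t, ρ.real (Set.Ici t) ∂ρ := by rw [hswap]; ring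
    _ = ∫ t, (ρ.real (Set.Iic t) + ρ.real (Set.Ici t)) ∂ρ := (integral_add h2 h1).symm
    _ = ρ.real Set.univ ^ 2 := by simp_rw [hsum]; simp [sq]

/-- `integral_measureReal_Iic` for the restriction of `μ` to `Iic x`. This integral is the factor `u
(1 - u)` of the copula. -/
lemma setIntegral_one_sub_two_cdf (μ : Measure ℝ) [IsProbabilityMeasure μ] [NullSingletonClass μ] (x : ℝ) :
    ∫ t in Set.Iic x, (1 - 2 * cdf μ t) ∂μ = cdf μ x * (1 - cdf μ x) := by
  have h := integral_measureReal_Iic (μ.restrict (Set.Iic x))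
  have h1 : ∫ t in Set.Iic x, cdf μ t ∂μ
      = ∫ t in Set.Iic x, (μ.restrict (Set.Iic x)).real (Set.Iic t) ∂μ := by
    refine setIntegral_congr_fun measurableSet_Iic fun t ht => ?_
    simp only [measureReal_def, Measure.restrict_apply measurableSet_Iic]
    rw [Set.inter_eq_left.2 (Set.Iic_subset_Iic.2 ht), cdf_eq_real]; rfl
  rw [integral_sub (integrable_const _) ((integrable_cdf μ _).const_mul 2), integral_const_mul, h1,
    h]
  simp [cdf_eq_real]; ring

lemma integral_one_sub_two_cdf (μ : Measure ℝ) [IsProbabilityMeasure μ] [NullSingletonClass μ] :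
    ∫ t, (1 - 2 * cdf μ t) ∂μ = 0 := by
  have h := integral_measureReal_Iic μ
  rw [integral_sub (integrable_const _) ((integrable_cdf μ _).const_mul 2), integral_const_mul]
  simp_rw [cdf_eq_real]
  rw [h]; simp

/-- The density of the Farlie-Gumbel-Morgenstern coupling with respect to the product law. -/
noncomputable def fgmDensity (θ : ℝ) (μ ν : Measure ℝ) (q : ℝ × ℝ) : ℝ :=
  1 + θ * (1 - 2 * cdf μ q.1) * (1 - 2 * cdf ν q.2)

lemma abs_mul_mul_le_one {θ u v : ℝ} (h : |θ| ≤ 1) (hu : |u| ≤ 1) (hv : |v| ≤ 1) :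
    |θ * u * v| ≤ 1 := by
  rw [abs_mul, abs_mul]
  exact mul_le_one₀ (mul_le_one₀ h (abs_nonneg _) hu) (abs_nonneg _) hv

lemma fgmDensity_nonneg {θ : ℝ} (hθ : |θ| ≤ 1) (μ ν : Measure ℝ) (q : ℝ × ℝ) :
    0 ≤ fgmDensity θ μ ν q := by
  have := abs_le.1 (abs_mul_mul_le_one hθ (abs_one_sub_two_cdf_le μ q.1)
    (abs_one_sub_two_cdf_le ν q.2))
  unfold fgmDensity; linarith

lemma fgmDensity_le {θ : ℝ} (hθ : |θ| ≤ 1) (μ ν : Measure ℝ) (q : ℝ × ℝ) :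
    fgmDensity θ μ ν q ≤ 2 := by
  have := abs_le.1 (abs_mul_mul_le_one hθ (abs_one_sub_two_cdf_le μ q.1)
    (abs_one_sub_two_cdf_le ν q.2))
  unfold fgmDensity; linarith

lemma measurable_fgmDensity (θ : ℝ) (μ ν : Measure ℝ) : Measurable (fgmDensity θ μ ν) := by
  have h1 := (measurable_cdf μ).comp (measurable_fst : Measurable (Prod.fst : ℝ × ℝ → ℝ))
  have h2 := (measurable_cdf ν).comp (measurable_snd : Measurable (Prod.snd : ℝ × ℝ → ℝ))
  unfold fgmDensity
  exact measurable_const.add (((measurable_const.sub (h1.const_mul 2)).const_mul θ).mul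
    (measurable_const.sub (h2.const_mul 2)))

/-- One-dimensional uniqueness applied twice: in the first coordinate with a half-line fixed in the
second, then in the second with an arbitrary measurable set fixed in the first. -/
lemma measure_prod_ext_of_Iic {m m' : Measure (ℝ × ℝ)} [IsFiniteMeasure m] [IsFiniteMeasure m']
    (h : ∀ x y, m (Set.Iic x ×ˢ Set.Iic y) = m' (Set.Iic x ×ˢ Set.Iic y)) : m = m' := by
  have step1 : ∀ y, ∀ A, MeasurableSet A → m (A ×ˢ Set.Iic y) = m' (A ×ˢ Set.Iic y) := by
    intro y A hA
    have := Measure.ext_of_Iic ((m.restrict (Set.univ ×ˢ Set.Iic y)).map Prod.fst)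
      ((m'.restrict (Set.univ ×ˢ Set.Iic y)).map Prod.fst) (fun x => by
        rw [Measure.map_apply measurable_fst measurableSet_Iic,
          Measure.map_apply measurable_fst measurableSet_Iic,
          Measure.restrict_apply (measurable_fst measurableSet_Iic),
          Measure.restrict_apply (measurable_fst measurableSet_Iic),
          ← Set.prod_univ, Set.prod_inter_prod]
        simpa using h x y)
    have h2 := DFunLike.congr_fun this A
    rw [Measure.map_apply measurable_fst hA,
          Measure.map_apply measurable_fst hA,
          Measure.restrict_apply (measurable_fst hA),
          Measure.restrict_apply (measurable_fst hA),
          ← Set.prod_univ, Set.prod_inter_prod] at h2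
    simpa using h2
  refine Measure.ext_prod fun {A B} hA hB => ?_
  have := Measure.ext_of_Iic ((m.restrict (A ×ˢ Set.univ)).map Prod.snd)
      ((m'.restrict (A ×ˢ Set.univ)).map Prod.snd) (fun x => by
        rw [Measure.map_apply measurable_snd measurableSet_Iic,
          Measure.map_apply measurable_snd measurableSet_Iic,
          Measure.restrict_apply (measurable_snd measurableSet_Iic),
          Measure.restrict_apply (measurable_snd measurableSet_Iic),
          ← Set.univ_prod, Set.prod_inter_prod]
        simpa using step1 x A hA)
  have h2 := DFunLike.congr_fun this B

  rw [Measure.map_apply measurable_snd hB,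
          Measure.map_apply measurable_snd hB,
          Measure.restrict_apply (measurable_snd hB),
          Measure.restrict_apply (measurable_snd hB),
          ← Set.univ_prod, Set.prod_inter_prod] at h2
  simpa using h2

lemma integrable_fgmDensity {θ : ℝ} (hθ : |θ| ≤ 1) (μ ν : Measure ℝ)
    (m : Measure (ℝ × ℝ)) [IsFiniteMeasure m] : Integrable (fgmDensity θ μ ν) m :=
  Integrable.of_bound (measurable_fgmDensity θ μ ν).aestronglyMeasurable 2
    (ae_of_all _ fun q => by
      rw [Real.norm_of_nonneg (fgmDensity_nonneg hθ μ ν q)]; exact fgmDensity_le hθ μ ν q)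

lemma setIntegral_fgmDensity {θ : ℝ} (hθ : |θ| ≤ 1) (μ ν : Measure ℝ) [IsProbabilityMeasure μ]
    [IsProbabilityMeasure ν] [NullSingletonClass μ] [NullSingletonClass ν] (x y : ℝ) :
    ∫ q in Set.Iic x ×ˢ Set.Iic y, fgmDensity θ μ ν q ∂(μ.prod ν)
      = fgmCopula θ (cdf μ x) (cdf ν y) := by
  rw [← Measure.prod_restrict, integral_prod _ (integrable_fgmDensity hθ μ ν _)]
  have h : ∀ t, ∫ u in Set.Iic y, fgmDensity θ μ ν (t, u) ∂ν
      = cdf ν y + (θ * (cdf ν y * (1 - cdf ν y))) * (1 - 2 * cdf μ t) := by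
    intro t
    simp only [fgmDensity]
    rw [integral_add (integrable_const _), integral_const_mul, setIntegral_one_sub_two_cdf]
    · simp [cdf_eq_real]; ring
    · exact ((integrable_const _).sub ((integrable_cdf ν _).const_mul 2)).const_mul _
  simp_rw [h]
  rw [integral_add (integrable_const _), integral_const_mul, setIntegral_one_sub_two_cdf]
  · simp [cdf_eq_real, fgmCopula]; ring
  · exact ((integrable_const _).sub ((integrable_cdf μ _).const_mul 2)).const_mul _

lemma eq_withDensity_fgmDensity {θ : ℝ} (hθ : |θ| ≤ 1) (μ ν : Measure ℝ)
    [IsProbabilityMeasure μ] [IsProbabilityMeasure ν] [NullSingletonClass μ] [NullSingletonClass ν]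
    (m : Measure (ℝ × ℝ)) [IsFiniteMeasure m]
    (hm : ∀ x y, m.real (Set.Iic x ×ˢ Set.Iic y) = fgmCopula θ (cdf μ x) (cdf ν y)) :
    m = (μ.prod ν).withDensity (fun q => ENNReal.ofReal (fgmDensity θ μ ν q)) := by
  have hfin : IsFiniteMeasure ((μ.prod ν).withDensity
      (fun q => ENNReal.ofReal (fgmDensity θ μ ν q))) :=
    isFiniteMeasure_withDensity_ofReal (integrable_fgmDensity hθ μ ν _).2
  refine measure_prod_ext_of_Iic fun x y => ?_
  rw [withDensity_apply _ (measurableSet_Iic.prod measurableSet_Iic),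
    ← ofReal_integral_eq_lintegral_ofReal (integrable_fgmDensity hθ μ ν _)
      (ae_of_all _ fun q => fgmDensity_nonneg hθ μ ν q),
    setIntegral_fgmDensity hθ, ← hm, ofReal_measureReal]

/-- Fubini for the density `fgmDensity`. The `J`-integral is innermost, so that exponential
computations can be carried out at a fixed value of `S`. -/
lemma integral_eq_of_fgm {θ : ℝ} (hθ : |θ| ≤ 1) (μ ν : Measure ℝ)
    [IsProbabilityMeasure μ] [IsProbabilityMeasure ν] [NullSingletonClass μ] [NullSingletonClass ν]
    (m : Measure (ℝ × ℝ)) [IsFiniteMeasure m]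
    (hm : ∀ x y, m.real (Set.Iic x ×ˢ Set.Iic y) = fgmCopula θ (cdf μ x) (cdf ν y))
    {h : ℝ × ℝ → ℂ} (hh : Measurable h) (C : ℝ) (hC : ∀ᵐ q ∂(μ.prod ν), ‖h q‖ ≤ C) :
    ∫ q, h q ∂m = ∫ x, (∫ y, h (x, y) ∂ν
      + θ * (1 - 2 * cdf μ x) * ∫ y, (1 - 2 * cdf ν y) * h (x, y) ∂ν) ∂μ := by
  have hhi : Integrable h (μ.prod ν) := Integrable.of_bound hh.aestronglyMeasurable C hC
  have hd : Integrable (fun q => fgmDensity θ μ ν q • h q) (μ.prod ν) := by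
    refine hhi.bdd_smul 2 (measurable_fgmDensity θ μ ν).aestronglyMeasurable
      (ae_of_all _ fun q => ?_)
    rw [Real.norm_of_nonneg (fgmDensity_nonneg hθ μ ν q)]; exact fgmDensity_le hθ μ ν q
  rw [eq_withDensity_fgmDensity hθ μ ν m hm, integral_withDensity_eq_integral_toReal_smul
    (measurable_fgmDensity θ μ ν).ennreal_ofReal (ae_of_all _ fun _ => ENNReal.ofReal_lt_top)]
  simp_rw [ENNReal.toReal_ofReal (fgmDensity_nonneg hθ μ ν _)]
  rw [integral_prod _ hd]
  refine integral_congr_ae ?_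
  filter_upwards [hhi.prod_right_ae] with x hx
  have hx' : Integrable (fun y => (1 - 2 * (cdf ν y : ℂ)) * h (x, y)) ν := by
    refine hx.bdd_mul (c := 1) ?_ (ae_of_all _ fun y => ?_)
    · have := measurable_cdf ν
      exact (by fun_prop : Measurable fun y => 1 - 2 * ((cdf ν y : ℝ) : ℂ)).aestronglyMeasurable
    · have := abs_one_sub_two_cdf_le ν y
      rw [← Real.norm_eq_abs, ← Complex.norm_real] at this
      simpa using this
  rw [← integral_const_mul, ← integral_add hx (hx'.const_mul _)]
  refine integral_congr_ae (ae_of_all _ fun y => ?_)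
  simp only [fgmDensity, Complex.real_smul]
  push_cast; ring

/-! ### The one-step transform: exponential integrals and the coupled increment -/

instance nullSingletonClass_lawOfDensity (f : ℝ → ℝ) : NullSingletonClass (lawOfDensity f) := by
  refine ⟨fun x => ?_⟩
  refine withDensity_absolutelyContinuous _ _ ?_
  simp

lemma ae_pos_lawOfDensity (f : ℝ → ℝ) : ∀ᵐ x ∂(lawOfDensity f), 0 < x :=
  (withDensity_absolutelyContinuous _ _).ae_le (ae_restrict_mem measurableSet_Ioi)

lemma integral_lawOfDensity {E : Type*} [NormedAddCommGroup E] [NormedSpace ℝ E] {f : ℝ → ℝ}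
    (hfm : Measurable f) (hf0 : ∀ x, 0 ≤ f x) (h : ℝ → E) :
    ∫ x, h x ∂(lawOfDensity f) = ∫ x in Set.Ioi 0, f x • h x := by
  rw [lawOfDensity, integral_withDensity_eq_integral_toReal_smul hfm.ennreal_ofReal
    (ae_of_all _ fun _ => ENNReal.ofReal_lt_top)]
  simp_rw [ENNReal.toReal_ofReal (hf0 _)]

lemma gStar_eq_integral {f : ℝ → ℝ} (hfm : Measurable f) (hf0 : ∀ x, 0 ≤ f x) (s : ℂ) :
    gStar f s = ∫ x, (1 - 2 * (cdf (lawOfDensity f) x : ℂ)) * Complex.exp (-s * (x : ℂ))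
      ∂(lawOfDensity f) := by
  rw [integral_lawOfDensity hfm hf0, gStar]
  refine setIntegral_congr_fun measurableSet_Ioi fun x _ => ?_
  simp only [gFun, Complex.real_smul]
  push_cast; ring

lemma integral_expMeasure {r : ℝ} (hr : 0 < r) (h : ℝ → ℂ) :
    ∫ y, h y ∂(expMeasure r) = ∫ y in Set.Ioi (0 : ℝ), (r * Complex.exp (-r * y)) * h y := by
  have h1 : expMeasure r = volume.withDensity (fun y => ENNReal.ofReal (exponentialPDFReal r y)) :=
    rfl
  rw [h1, integral_withDensity_eq_integral_toReal_smul
    (measurable_exponentialPDFReal r).ennreal_ofReal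
    (ae_of_all _ fun _ => ENNReal.ofReal_lt_top), ← integral_Ici_eq_integral_Ioi,
    ← integral_indicator measurableSet_Ici]
  refine integral_congr_ae (ae_of_all _ fun y => ?_)
  simp only
  have h2 := exponentialPDF_eq r y
  unfold exponentialPDF at h2
  rw [h2]
  by_cases hy : 0 ≤ y
  · rw [if_pos hy, Set.indicator_of_mem (show y ∈ Set.Ici 0 from hy),
      ENNReal.toReal_ofReal (by positivity), Complex.real_smul]
    push_cast; ring_nf
  · rw [if_neg hy, Set.indicator_of_notMem (show y ∉ Set.Ici 0 from hy)]
    simp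

instance nullSingletonClass_expMeasure (r : ℝ) : NullSingletonClass (expMeasure r) :=
  ⟨fun x => withDensity_absolutelyContinuous _ _ (by simp)⟩

lemma norm_cexp_neg_mul_le_one {s : ℂ} (hs : 0 ≤ s.re) {t : ℝ} (ht : 0 ≤ t) :
    ‖Complex.exp (-s * (t : ℂ))‖ ≤ 1 := by
  rw [Complex.norm_exp]
  simp only [Complex.mul_re, Complex.neg_re, Complex.ofReal_re, Complex.neg_im,
    Complex.ofReal_im, mul_zero, sub_zero]
  rw [Real.exp_le_one_iff]
  nlinarith

lemma integrableOn_exp_mul_cexp_max {r : ℝ} (hr : 0 < r) {s : ℂ} (hs : 0 ≤ s.re) (X : ℝ) :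
    IntegrableOn (fun y : ℝ => (r * Complex.exp (-r * y)) *
      Complex.exp (-s * ((max (X - y) 0 : ℝ) : ℂ))) (Set.Ioi 0) := by
  have h1 : IntegrableOn (fun y : ℝ => (r : ℂ) * Complex.exp (-r * y)) (Set.Ioi 0) :=
    (integrableOn_exp_mul_complex_Ioi (by simpa using hr) 0).const_mul _
  refine Integrable.mul_bdd (c := 1) h1 ?_ (ae_of_all _ fun y =>
    norm_cexp_neg_mul_le_one hs (le_max_right _ _))
  exact (by fun_prop : Continuous fun y : ℝ =>
    Complex.exp (-s * ((max (X - y) 0 : ℝ) : ℂ))).aestronglyMeasurable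

/-- Split at `y = X`: below it the integrand is a single exponential, above it the positive part is
zero and only the exponential tail remains. -/
lemma setIntegral_exp_mul_cexp_max {r : ℝ} (hr : 0 < r) {s : ℂ} (hs : 0 ≤ s.re) (hsr : s ≠ r)
    {X : ℝ} (hX : 0 ≤ X) :
    ∫ y in Set.Ioi (0 : ℝ), (r * Complex.exp (-r * y)) *
      Complex.exp (-s * ((max (X - y) 0 : ℝ) : ℂ))
      = (r * Complex.exp (-s * X) - s * Complex.exp (-r * X)) / (r - s) := by
  have hI := integrableOn_exp_mul_cexp_max hr hs X
  have hsr' : s - r ≠ 0 := sub_ne_zero.2 hsr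
  have hrs' : (r : ℂ) - s ≠ 0 := sub_ne_zero.2 hsr.symm
  rw [← Set.Ioc_union_Ioi_eq_Ioi hX, setIntegral_union (Set.Ioc_disjoint_Ioi le_rfl)
    measurableSet_Ioi (hI.mono_set Set.Ioc_subset_Ioi_self)
    (hI.mono_set (Set.Ioi_subset_Ioi hX))]
  have e1 : ∫ y in Set.Ioc 0 X, (r * Complex.exp (-r * y)) *
      Complex.exp (-s * ((max (X - y) 0 : ℝ) : ℂ))
      = r * Complex.exp (-s * X) * ((Complex.exp ((s - r) * X) - 1) / (s - r)) := by
    have : ∀ y ∈ Set.Ioc 0 X, (r * Complex.exp (-r * y)) *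
      Complex.exp (-s * ((max (X - y) 0 : ℝ) : ℂ))
      = r * Complex.exp (-s * X) * Complex.exp ((s - r) * y) := by
      intro y hy
      rw [max_eq_left (sub_nonneg.2 hy.2), mul_assoc, mul_assoc, ← Complex.exp_add,
        ← Complex.exp_add]
      push_cast; ring_nf
    rw [setIntegral_congr_fun measurableSet_Ioc this, integral_const_mul,
      ← intervalIntegral.integral_of_le hX, integral_exp_mul_complex hsr']
    simp
  have e2 : ∫ y in Set.Ioi X, (r * Complex.exp (-r * y)) *
      Complex.exp (-s * ((max (X - y) 0 : ℝ) : ℂ)) = Complex.exp (-r * X) := by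
    have : ∀ y ∈ Set.Ioi X, (r * Complex.exp (-r * y)) *
      Complex.exp (-s * ((max (X - y) 0 : ℝ) : ℂ)) = r * Complex.exp (-r * y) := by
      intro y hy
      rw [max_eq_right (sub_nonpos.2 (le_of_lt hy))]; simp
    rw [setIntegral_congr_fun measurableSet_Ioi this, integral_const_mul,
      integral_exp_mul_complex_Ioi (by simpa using hr)]
    have : (r : ℂ) ≠ 0 := by exact_mod_cast hr.ne'
    field_simp
  rw [e1, e2]
  have e3 : Complex.exp (-s * X) * Complex.exp ((s - r) * X) = Complex.exp (-r * X) := by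
    rw [← Complex.exp_add]; ring_nf
  generalize Complex.exp (-s * X) = a at e3 ⊢
  generalize Complex.exp ((s - r) * X) = b at e3 ⊢
  rw [← e3]
  field_simp
  ring

lemma integral_expMeasure_cexp_max {r : ℝ} (hr : 0 < r) {s : ℂ} (hs : 0 ≤ s.re) (hsr : s ≠ r)
    {X : ℝ} (hX : 0 ≤ X) :
    ∫ y, Complex.exp (-s * ((max (X - y) 0 : ℝ) : ℂ)) ∂(expMeasure r)
      = (r * Complex.exp (-s * X) - s * Complex.exp (-r * X)) / (r - s) := by
  rw [integral_expMeasure hr, setIntegral_exp_mul_cexp_max hr hs hsr hX]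

/-- Since `1 - 2F(y) = 2e^{-ry} - 1`, weighting by it replaces the density `r e^{-ry}` by `2r
e^{-2ry} - r e^{-ry}`. The previous formula at rates `2r` and `r` then applies; this is the source
of the pole at `2λ`. -/
lemma integral_expMeasure_cdf_mul_cexp_max {r : ℝ} (hr : 0 < r) {s : ℂ} (hs : 0 ≤ s.re)
    (hsr : s ≠ r) (hsr2 : s ≠ 2 * r) {X : ℝ} (hX : 0 ≤ X) :
    ∫ y, (1 - 2 * (cdf (expMeasure r) y : ℂ)) * Complex.exp (-s * ((max (X - y) 0 : ℝ) : ℂ))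
        ∂(expMeasure r)
      = (2 * r * Complex.exp (-s * X) - s * Complex.exp (-(2 * r) * X)) / (2 * r - s)
        - (r * Complex.exp (-s * X) - s * Complex.exp (-r * X)) / (r - s) := by
  have h2 := setIntegral_exp_mul_cexp_max (r := 2 * r) (by positivity) hs
    (by push_cast; exact hsr2) hX
  push_cast at h2
  rw [integral_expMeasure hr, ← setIntegral_exp_mul_cexp_max hr hs hsr hX, ← h2,
    ← integral_sub (by simpa [IntegrableOn] using integrableOn_exp_mul_cexp_max (r := 2 * r) (by positivity) hs X)
      (integrableOn_exp_mul_cexp_max hr hs X)]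
  refine setIntegral_congr_fun measurableSet_Ioi fun y hy => ?_
  have hy' : (0 : ℝ) ≤ y := le_of_lt hy
  simp only [cdf_expMeasure_eq hr, if_pos hy']
  have : Complex.exp (-(2 * r) * y) = Complex.exp (-r * y) * Complex.exp (-r * y) := by
    rw [← Complex.exp_add]; ring_nf
  rw [this]
  push_cast
  ring_nf

lemma integrable_cexp_neg_mul {μ : Measure ℝ} [IsFiniteMeasure μ] (hμ : ∀ᵐ x ∂μ, 0 ≤ x) {s : ℂ}
    (hs : 0 ≤ s.re) : Integrable (fun x : ℝ => Complex.exp (-s * (x : ℂ))) μ :=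
  Integrable.of_bound (by fun_prop : Continuous fun x : ℝ =>
    Complex.exp (-s * (x : ℂ))).aestronglyMeasurable 1
    (hμ.mono fun _ hx => norm_cexp_neg_mul_le_one hs hx)

lemma norm_one_sub_two_cdf_le (μ : Measure ℝ) (x : ℝ) : ‖1 - 2 * (cdf μ x : ℂ)‖ ≤ 1 := by
  have := abs_one_sub_two_cdf_le μ x
  rw [← Real.norm_eq_abs, ← Complex.norm_real] at this
  simpa using this

lemma measurable_one_sub_two_cdf (μ : Measure ℝ) :
    Measurable fun x => 1 - 2 * (cdf μ x : ℂ) := by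
  have := measurable_cdf μ
  fun_prop

lemma integrable_cdf_mul_cexp {μ : Measure ℝ} [IsFiniteMeasure μ] (hμ : ∀ᵐ x ∂μ, 0 ≤ x) {s : ℂ}
    (hs : 0 ≤ s.re) :
    Integrable (fun x : ℝ => (1 - 2 * (cdf μ x : ℂ)) * Complex.exp (-s * (x : ℂ))) μ :=
  (integrable_cexp_neg_mul hμ hs).bdd_mul (c := 1)
    (measurable_one_sub_two_cdf μ).aestronglyMeasurable
    (ae_of_all _ fun x => norm_one_sub_two_cdf_le μ x)

/-- The transform of `[w + b S - J]⁺` when `(S, J)` has the coupled law. -/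
lemma integral_coupled_cexp_max {lam θ : ℝ} (hlam : 0 < lam) (hθ : |θ| ≤ 1) {f : ℝ → ℝ}
    (hfm : Measurable f) (hf0 : ∀ x, 0 ≤ f x) [IsProbabilityMeasure (lawOfDensity f)]
    (m : Measure (ℝ × ℝ)) [IsFiniteMeasure m]
    (hm : ∀ x y, m.real (Set.Iic x ×ˢ Set.Iic y) =
      fgmCopula θ (cdf (lawOfDensity f) x) (cdf (expMeasure lam) y))
    {b w : ℝ} (hb : 0 < b) (hw : 0 ≤ w) {s : ℂ} (hs : 0 ≤ s.re) (h1 : s ≠ lam)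
    (h2 : s ≠ 2 * lam) :
    ∫ q, Complex.exp (-s * ((max (w + b * q.1 - q.2) 0 : ℝ) : ℂ)) ∂m
      = Complex.exp (-s * w) * ((lam : ℂ) / (lam - s) * phi f (b * s)
          - θ * (s * lam / ((lam - s) * (2 * lam - s))) * gStar f (b * s))
        + s * ((θ * gStar f (b * lam) - phi f (b * lam)) / (lam - s) * Complex.exp (-lam * w)
          - θ * gStar f (2 * b * lam) / (2 * lam - s) * Complex.exp (-(2 * lam) * w)) := by
  have := isProbabilityMeasure_expMeasure hlam
  have h1' : (lam : ℂ) - s ≠ 0 := sub_ne_zero.2 h1.symm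
  have h2' : 2 * (lam : ℂ) - s ≠ 0 := sub_ne_zero.2 h2.symm
  have hpos : ∀ᵐ x ∂(lawOfDensity f), 0 ≤ x := (ae_pos_lawOfDensity f).mono fun _ => le_of_lt
  rw [integral_eq_of_fgm hθ (lawOfDensity f) (expMeasure lam) m hm (by fun_prop) 1
    (ae_of_all _ fun q => norm_cexp_neg_mul_le_one hs (le_max_right _ _))]
  have hre : ∀ z : ℂ, 0 ≤ z.re → 0 ≤ ((b : ℂ) * z).re := fun z hz => by
    simpa using mul_nonneg hb.le hz
  have hre2 : 0 ≤ (2 * (b : ℂ) * lam).re := by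
    have : (2 * (b : ℂ) * lam).re = 2 * b * lam := by
      rw [← Complex.ofReal_re (2 * b * lam)]; push_cast; rfl
    rw [this]; positivity
  have hrl : 0 ≤ ((b : ℂ) * lam).re := hre _ (by simpa using hlam.le)
  -- After the `J`-integration five functions of `x` remain; their integrals are `φ_S(bs)`,
  -- `g*(bs)`, `g*(bλ)`, `φ_S(bλ)` and `g*(2bλ)`, in this order.
  have key : ∀ᵐ x ∂(lawOfDensity f),
      (∫ y, Complex.exp (-s * ((max (w + b * (x, y).1 - (x, y).2) 0 : ℝ) : ℂ)) ∂(expMeasure lam)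
        + θ * (1 - 2 * (cdf (lawOfDensity f) x : ℂ)) * ∫ y, (1 - 2 * (cdf (expMeasure lam) y : ℂ)) *
          Complex.exp (-s * ((max (w + b * (x, y).1 - (x, y).2) 0 : ℝ) : ℂ)) ∂(expMeasure lam))
      = (Complex.exp (-s * w) * (lam / (lam - s))) * Complex.exp (-(b * s) * x)
        + (-(Complex.exp (-s * w) * (θ * (s * lam / ((lam - s) * (2 * lam - s)))))) *
            ((1 - 2 * (cdf (lawOfDensity f) x : ℂ)) * Complex.exp (-(b * s) * x))
        + (s * θ / (lam - s) * Complex.exp (-lam * w)) *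
            ((1 - 2 * (cdf (lawOfDensity f) x : ℂ)) * Complex.exp (-(b * lam) * x))
        + (-(s / (lam - s) * Complex.exp (-lam * w))) * Complex.exp (-(b * lam) * x)
        + (-(s * θ / (2 * lam - s) * Complex.exp (-(2 * lam) * w))) *
            ((1 - 2 * (cdf (lawOfDensity f) x : ℂ)) * Complex.exp (-(2 * b * lam) * x)) := by
    filter_upwards [hpos] with x hx
    have hX : 0 ≤ w + b * x := by positivity
    rw [integral_expMeasure_cexp_max hlam hs h1 hX,
      integral_expMeasure_cdf_mul_cexp_max hlam hs h1 h2 hX]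
    have e : ∀ z : ℂ, Complex.exp (-z * ((w + b * x : ℝ) : ℂ))
        = Complex.exp (-z * w) * Complex.exp (-(b * z) * x) := fun z => by
      rw [← Complex.exp_add]; push_cast; ring_nf
    rw [e, e, e, show (b : ℂ) * (2 * lam) = 2 * b * lam by ring]
    generalize Complex.exp (-s * w) = A
    generalize Complex.exp (-lam * w) = B
    generalize Complex.exp (-(2 * lam) * w) = D
    generalize Complex.exp (-(b * s) * x) = E
    generalize Complex.exp (-(b * lam) * x) = F
    generalize Complex.exp (-(2 * b * lam) * x) = G
    have h2'' : (lam : ℂ) * 2 - s ≠ 0 := by rwa [mul_comm]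
    field_simp
    ring
  rw [integral_congr_ae key]
  have i1 := integrable_cexp_neg_mul hpos (hre s hs)
  have i2 := integrable_cdf_mul_cexp hpos (hre s hs)
  have i3 := integrable_cdf_mul_cexp hpos hrl
  have i4 := integrable_cexp_neg_mul hpos hrl
  have i5 := integrable_cdf_mul_cexp hpos hre2
  have j1 := (i1.const_mul (Complex.exp (-s * w) * (lam / (lam - s))))
  have j2 := (i2.const_mul (-(Complex.exp (-s * w) *
    (θ * (s * lam / ((lam - s) * (2 * lam - s)))))))
  have j3 := (i3.const_mul (s * θ / (lam - s) * Complex.exp (-lam * w)))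
  have j4 := (i4.const_mul (-(s / (lam - s) * Complex.exp (-lam * w))))
  have j5 := (i5.const_mul (-(s * θ / (2 * lam - s) * Complex.exp (-(2 * lam) * w))))
  rw [integral_add (by exact ((j1.add j2).add j3).add j4) j5,
    integral_add (by exact (j1.add j2).add j3) j4, integral_add (by exact j1.add j2) j3,
    integral_add j1 j2]
  simp only [integral_const_mul]
  rw [← gStar_eq_integral hfm hf0, ← gStar_eq_integral hfm hf0, ← gStar_eq_integral hfm hf0]
  simp only [phi, lst]
  ring

/-- The transform of `[w + S - A]⁺` for one triple of the model. -/
lemma integral_increment_cexp_max {Ω : Type*} [MeasurableSpace Ω] {P : Measure Ω}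
    [IsProbabilityMeasure P] {N : ℕ} {lam θ : ℝ} {a p : Fin N → ℝ} {f : ℝ → ℝ}
    {S J Om : Ω → ℝ} (hlam : 0 < lam) (hθ : |θ| ≤ 1)
    (ha : ∀ i, a i < 1) (hp : ∀ i, 0 ≤ p i)
    (hfm : Measurable f) (hf0 : ∀ x, 0 ≤ f x)
    (hSm : Measurable S) (hJm : Measurable J) (hOm : Measurable Om)
    (hS : P.map S = lawOfDensity f) (hJ : P.map J = expMeasure lam)
    (hOmlaw : P.map Om = ∑ i, ENNReal.ofReal (p i) • Measure.dirac (a i))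
    (hSJ : ∀ x y, P.real {ω | S ω ≤ x ∧ J ω ≤ y} =
      fgmCopula θ (cdf (P.map S) x) (cdf (P.map J) y))
    (hOmind : IndepFun Om (fun ω => (S ω, J ω)) P)
    {w : ℝ} (hw : 0 ≤ w) {s : ℂ} (hs : 0 ≤ s.re) (h1 : s ≠ lam) (h2 : s ≠ 2 * lam) :
    ∫ ω, Complex.exp (-s * ((max (w + (S ω - (Om ω * S ω + J ω))) 0 : ℝ) : ℂ)) ∂P
      = Complex.exp (-s * w) * (1 - bracket lam θ a p f s)
        + rhs lam θ a p f (Complex.exp (-lam * w)) (Complex.exp (-(2 * lam) * w)) s := by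
  have : IsProbabilityMeasure (lawOfDensity f) := by
    rw [← hS]; exact Measure.isProbabilityMeasure_map hSm.aemeasurable
  set m := P.map (fun ω => (S ω, J ω)) with hmdef
  have hpm : IsProbabilityMeasure m :=
    Measure.isProbabilityMeasure_map (hSm.prodMk hJm).aemeasurable
  have hOmp : IsProbabilityMeasure (P.map Om) :=
    Measure.isProbabilityMeasure_map hOm.aemeasurable
  have hm : ∀ x y, m.real (Set.Iic x ×ˢ Set.Iic y) =
      fgmCopula θ (cdf (lawOfDensity f) x) (cdf (expMeasure lam) y) := by
    intro x y
    rw [← hS, ← hJ, ← hSJ, hmdef, map_measureReal_apply (hSm.prodMk hJm)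
      (measurableSet_Iic.prod measurableSet_Iic)]
    rfl
  have hlaw : P.map (fun ω => (Om ω, (S ω, J ω))) = (P.map Om).prod m :=
    (indepFun_iff_map_prod_eq_prod_map_map hOm.aemeasurable (hSm.prodMk hJm).aemeasurable).1 hOmind
  let h : ℝ × ℝ × ℝ → ℂ := fun q =>
    Complex.exp (-s * ((max (w + (q.2.1 - (q.1 * q.2.1 + q.2.2))) 0 : ℝ) : ℂ))
  have hh : Measurable h := by fun_prop
  have hhi : Integrable h ((P.map Om).prod m) := Integrable.of_bound hh.aestronglyMeasurable 1
    (ae_of_all _ fun q => norm_cexp_neg_mul_le_one hs (le_max_right _ _))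
  have e1 : ∫ ω, Complex.exp (-s * ((max (w + (S ω - (Om ω * S ω + J ω))) 0 : ℝ) : ℂ)) ∂P
      = ∫ x, ∫ q, h (x, q) ∂m ∂(P.map Om) := by
    rw [← integral_prod _ hhi, ← hlaw, integral_map (hOm.prodMk (hSm.prodMk hJm)).aemeasurable
      hh.aestronglyMeasurable]
  have hint : ∀ i ∈ Finset.univ, Integrable (fun x => ∫ q, h (x, q) ∂m)
      (ENNReal.ofReal (p i) • Measure.dirac (a i)) := fun i _ =>
    (integrable_dirac (by simp)).smul_measure ENNReal.ofReal_ne_top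
  rw [e1, hOmlaw, integral_finsetSum_measure hint]
  have e2 : ∀ i, ∫ x, ∫ q, h (x, q) ∂m ∂(ENNReal.ofReal (p i) • Measure.dirac (a i))
      = p i * (Complex.exp (-s * w) * ((lam : ℂ) / (lam - s) * phi f ((1 - a i) * s)
          - θ * (s * lam / ((lam - s) * (2 * lam - s))) * gStar f ((1 - a i) * s))
        + s * ((θ * gStar f ((1 - a i) * lam) - phi f ((1 - a i) * lam)) / (lam - s)
            * Complex.exp (-lam * w)
          - θ * gStar f (2 * (1 - a i) * lam) / (2 * lam - s)
            * Complex.exp (-(2 * lam) * w))) := by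
    intro i
    have hk := integral_coupled_cexp_max hlam hθ hfm hf0 m hm (sub_pos.2 (ha i)) hw hs h1 h2
    push_cast at hk
    rw [integral_smul_measure, integral_dirac, ENNReal.toReal_ofReal (hp i), Complex.real_smul,
      ← hk]
    congr 1
    refine integral_congr_ae (ae_of_all _ fun q => ?_)
    simp only [h]
    ring_nf
  rw [Finset.sum_congr rfl fun i _ => e2 i]
  simp only [mul_add, Finset.sum_add_distrib, bracket, rhs, sub_sub_cancel]
  rw [Finset.mul_sum, Finset.mul_sum]
  congr 1 <;> exact Finset.sum_congr rfl fun i _ => by ring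

/-- The left side is the one-step transform at `w = 0`, that is, the transform of `[S - A]⁺`. -/
lemma one_sub_bracket_add_rhs_one (lam θ : ℝ) {N : ℕ} (a p : Fin N → ℝ) (f : ℝ → ℝ) (s : ℂ) :
    1 - bracket lam θ a p f s + rhs lam θ a p f 1 1 s = maxFactor lam θ a p f s := by
  simp only [bracket, rhs, maxFactor, sub_sub_cancel]
  rw [Finset.mul_sum, ← Finset.sum_add_distrib]
  exact Finset.sum_congr rfl fun i _ => by ring

lemma minFactor_eq (lam θ : ℝ) {N : ℕ} (a p : Fin N → ℝ) (f : ℝ → ℝ) (s : ℂ) :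
    minFactor lam θ a p f s = 2 - maxFactor lam θ a p f s := by
  simp only [minFactor, maxFactor]
  rw [sub_eq_add_neg (2 : ℂ), ← Finset.sum_neg_distrib]
  congr 1
  exact Finset.sum_congr rfl fun i _ => by ring

/-! ### The Lindley recursion and its reversal -/

/-- The Lindley recursion with starting value `w` and increments `x`. -/
noncomputable def lindley (w : ℝ) (x : ℕ → ℝ) : ℕ → ℝ
  | 0 => w
  | n + 1 => max (lindley w x n + x n) 0

lemma waiting_eq_lindley {Ω : Type*} (W0 : Ω → ℝ) (S A : ℕ → Ω → ℝ) (n : ℕ) (ω : Ω) :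
    waiting W0 S A n ω = lindley (W0 ω) (fun i => S i ω - A i ω) n := by
  induction n with
  | zero => rfl
  | succ n ih => simp only [waiting, lindley, ih, add_sub_assoc]

lemma lindley_nonneg {w : ℝ} (hw : 0 ≤ w) (x : ℕ → ℝ) (n : ℕ) : 0 ≤ lindley w x n := by
  cases n with
  | zero => exact hw
  | succ n => exact le_max_right _ _

lemma lindley_congr (w : ℝ) {x y : ℕ → ℝ} {n : ℕ} (h : ∀ i < n, x i = y i) :
    lindley w x n = lindley w y n := by
  induction n with
  | zero => rfl
  | succ n ih =>
    simp only [lindley]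
    rw [ih fun i hi => h i (hi.trans (Nat.lt_succ_self n)), h n (Nat.lt_succ_self n)]

lemma partialSups_add_const (T : ℕ → ℝ) (c : ℝ) (n : ℕ) :
    partialSups (fun k => T k + c) n = partialSups T n + c := by
  induction n with
  | zero => simp
  | succ n ih => rw [partialSups_add_one, ih, partialSups_add_one]; exact max_add_add_right _ _ _

/-- The Lindley recursion with reversed increments is a maximum of partial sums. -/
lemma lindley_reverse (w : ℝ) (x : ℕ → ℝ) (n : ℕ) :
    lindley w (fun i => x (n - i)) (n + 1) =
      max (w + ∑ i ∈ Finset.range (n + 1), x i)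
        (partialSups (fun k => ∑ i ∈ Finset.range k, x i) n) := by
  induction n generalizing x with
  | zero => simp [lindley]
  | succ n ih =>
    have hc : lindley w (fun i => x (n + 1 - i)) (n + 1)
        = lindley w (fun i => (fun j => x (j + 1)) (n - i)) (n + 1) := by
      refine lindley_congr w fun i hi => ?_
      show x (n + 1 - i) = x (n - i + 1)
      congr 1; omega
    -- In reversed order `x 0` is the increment applied last; it is peeled off every nonempty
    -- partial sum, which leaves the shifted sequence to the induction hypothesis.
    have h : ∀ k, ∑ i ∈ Finset.range (k + 1), x i = ∑ i ∈ Finset.range k, x (i + 1) + x 0 :=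
      fun k => Finset.sum_range_succ' x k
    have h2 : (fun k => ∑ i ∈ Finset.range k, x i) ∘ (fun k => k + 1)
        = fun k => ∑ i ∈ Finset.range k, x (i + 1) + x 0 := funext h
    rw [lindley, hc, ih (fun j => x (j + 1)), partialSups_add_one', h2, partialSups_add_const,
      h (n + 1), ← add_assoc, Nat.sub_self, ← max_add_add_right, max_assoc]
    congr 1
    rw [max_comm]
    simp

lemma measurable_lindley (n : ℕ) :
    Measurable fun q : ℝ × (ℕ → ℝ) => lindley q.1 q.2 n := by
  induction n with
  | zero => exact measurable_fst
  | succ n ih =>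
    exact (ih.add ((measurable_pi_apply n).comp measurable_snd)).max measurable_const

/-- The partial sums tend to `-∞`, so the sequence is eventually constant. -/
lemma tendsto_reversed_lindley {w : ℝ} {x : ℕ → ℝ} {m : ℝ} (hm : m < 0)
    (h : Tendsto (fun n : ℕ => (∑ i ∈ Finset.range n, x i) / n) atTop (nhds m)) :
    ∃ l, Tendsto (fun n => max (w + ∑ i ∈ Finset.range (n + 1), x i)
        (partialSups (fun k => ∑ i ∈ Finset.range k, x i) n)) atTop (nhds l) := by
  set T : ℕ → ℝ := fun k => ∑ i ∈ Finset.range k, x i with hT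
  have hbot : Tendsto T atTop atBot := by
    have h1 : Tendsto (fun n : ℕ => (∑ i ∈ Finset.range n, x i) / n * n) atTop atBot :=
      h.neg_mul_atTop hm tendsto_natCast_atTop_atTop
    refine h1.congr' ?_
    filter_upwards [eventually_gt_atTop 0] with n hn
    have : (n : ℝ) ≠ 0 := by positivity
    exact div_mul_cancel₀ _ this
  -- Past `n0` a partial sum below `0` cannot raise the running maximum, which is nonnegative by the
  -- empty sum, and a partial sum below `-w` makes the term with the initial workload negligible.
  obtain ⟨n0, hn0⟩ := eventually_atTop.1 ((hbot.eventually_le_atBot 0).and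
    (hbot.eventually_le_atBot (-w)))
  have h0 : ∀ n, 0 ≤ partialSups T n := fun n =>
    le_trans (by simp [hT]) (le_partialSups_of_le T (Nat.zero_le n))
  refine ⟨partialSups T n0, tendsto_const_nhds.congr' ?_⟩
  filter_upwards [eventually_ge_atTop n0] with n hn
  have e : partialSups T n = partialSups T n0 := by
    induction n, hn using Nat.le_induction with
    | base => rfl
    | succ n hn ih =>
      rw [partialSups_add_one, ih, sup_eq_left]
      exact (hn0 (n + 1) (by omega)).1.trans (h0 _)
  rw [e, max_eq_right]
  have := (hn0 (n + 1) (by omega)).2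
  have h3 := h0 n0
  show w + T (n + 1) ≤ _
  linarith

/-! ### Convergence to the stationary law -/

section RandomWalk

variable {Ω : Type*} [MeasurableSpace Ω] {P : Measure Ω} [IsProbabilityMeasure P]

lemma IndepFun.prodMk_of_prodMk {α β γ : Type*} [MeasurableSpace α] [MeasurableSpace β]
    [MeasurableSpace γ] {X : Ω → α} {Y : Ω → β} {Z : Ω → γ} (hX : Measurable X)
    (hY : Measurable Y) (hZ : Measurable Z) (h1 : IndepFun X (fun ω => (Y ω, Z ω)) P)
    (h2 : IndepFun Y Z P) : IndepFun (fun ω => (X ω, Y ω)) Z P := by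
  have hpX := Measure.isProbabilityMeasure_map (μ := P) hX.aemeasurable
  have hpY := Measure.isProbabilityMeasure_map (μ := P) hY.aemeasurable
  have hpZ := Measure.isProbabilityMeasure_map (μ := P) hZ.aemeasurable
  have h3 : IndepFun X Y P := h1.comp measurable_id measurable_fst
  rw [indepFun_iff_map_prod_eq_prod_map_map (by fun_prop) (by fun_prop)] at h1 h2 h3 ⊢
  rw [h3]
  have e : (fun ω => ((X ω, Y ω), Z ω))
      = MeasurableEquiv.prodAssoc.symm ∘ fun ω => (X ω, (Y ω, Z ω)) := rfl
  rw [e, ← Measure.map_map (by fun_prop) (by fun_prop), h1, h2]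
  exact ((measurePreserving_prodAssoc _ _ _).symm).map_eq

/-- The state at time `n` depends only on `W0` and the increments before `n`. -/
lemma indepFun_lindley {W0 : Ω → ℝ} {X : ℕ → Ω → ℝ} (hW : Measurable W0)
    (hX : ∀ n, Measurable (X n)) (hind : iIndepFun X P)
    (hW0 : IndepFun W0 (fun ω n => X n ω) P) (n : ℕ) :
    IndepFun (fun ω => lindley (W0 ω) (fun i => X i ω) n) (X n) P := by
  let Y : Ω → (Finset.range n → ℝ) := fun ω i => X i ω
  have hY : Measurable Y := measurable_pi_lambda _ fun i => hX i
  have h2 : IndepFun Y (X n) P := by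
    have := hind.indepFun_finset (Finset.range n) {n} (by simp) hX
    exact this.comp measurable_id (measurable_pi_apply (⟨n, by simp⟩ : ({n} : Finset ℕ)))
  have h1 : IndepFun W0 (fun ω => (Y ω, X n ω)) P :=
    hW0.comp (ψ := fun x : ℕ → ℝ => ((fun i : Finset.range n => x i), x n)) measurable_id
      (by fun_prop)
  have h3 := IndepFun.prodMk_of_prodMk hW hY (hX n) h1 h2
  -- The filler value `0` is irrelevant: `lindley` at time `n` reads only indices below `n`.
  let ext : (Finset.range n → ℝ) → ℕ → ℝ := fun y i =>
    if h : i ∈ Finset.range n then y ⟨i, h⟩ else 0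
  have hext : Measurable ext := by
    refine measurable_pi_lambda _ fun i => ?_
    by_cases h : i ∈ Finset.range n
    · simp only [ext, h, dite_true]; exact measurable_pi_apply _
    · simp only [ext, h, dite_false]; exact measurable_const
  have h4 := h3.comp (φ := fun q : ℝ × (Finset.range n → ℝ) => lindley q.1 (ext q.2) n)
    ((measurable_lindley n).comp (measurable_fst.prodMk (hext.comp measurable_snd))) measurable_id
  refine h4.congr (ae_of_all _ fun ω => ?_) (ae_of_all _ fun ω => rfl)
  exact lindley_congr _ fun i hi => by simp [ext, Y, hi]

/-- The law of an i.i.d. sequence is invariant under injective reindexing, also jointly with the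
independent `W0`. -/
lemma map_lindley_reverse {W0 : Ω → ℝ} {X : ℕ → Ω → ℝ} (hW : Measurable W0)
    (hX : ∀ n, Measurable (X n)) (hind : iIndepFun X P)
    (hident : ∀ n, P.map (X n) = P.map (X 0))
    (hW0 : IndepFun W0 (fun ω n => X n ω) P) (n : ℕ) :
    P.map (fun ω => lindley (W0 ω) (fun i => X i ω) (n + 1)) =
      P.map (fun ω => lindley (W0 ω) (fun i => X (n - i) ω) (n + 1)) := by
  -- Indices above `n` are kept fixed: truncated `n - i` alone would send them all to `0` and lose
  -- injectivity.
  let σ : ℕ → ℕ := fun i => if i ≤ n then n - i else i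
  have hσ : Function.Injective σ := by
    intro i j hij
    simp only [σ] at hij
    split_ifs at hij <;> omega
  have hXm : Measurable (fun ω n => X n ω) := measurable_pi_lambda _ hX
  have hXσ : Measurable (fun ω n => X (σ n) ω) := measurable_pi_lambda _ fun n => hX _
  have e1 : P.map (fun ω n => X (σ n) ω) = P.map (fun ω n => X n ω) := by
    rw [hind.map_fun_eq_infinitePi_map hX,
      (hind.precomp hσ).map_fun_eq_infinitePi_map (fun n => hX (σ n))]
    congr 1
    ext1 i
    exact (hident (σ i)).trans (hident i).symm
  have hW0σ : IndepFun W0 (fun ω n => X (σ n) ω) P :=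
    hW0.comp (ψ := fun x : ℕ → ℝ => fun n => x (σ n)) measurable_id (by fun_prop)
  rw [indepFun_iff_map_prod_eq_prod_map_map hW.aemeasurable hXm.aemeasurable] at hW0
  rw [indepFun_iff_map_prod_eq_prod_map_map hW.aemeasurable hXσ.aemeasurable] at hW0σ
  have e2 : (fun ω => lindley (W0 ω) (fun i => X (n - i) ω) (n + 1))
      = fun ω => lindley (W0 ω) (fun i => X (σ i) ω) (n + 1) := by
    ext ω
    refine lindley_congr _ fun i hi => ?_
    simp only [σ]; rw [if_pos (by omega)]
  rw [e2]
  have e3 := Measure.map_map (μ := P) (measurable_lindley (n + 1)) (hW.prodMk hXm)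
  have e4 := Measure.map_map (μ := P) (measurable_lindley (n + 1)) (hW.prodMk hXσ)
  rw [hW0] at e3
  rw [hW0σ, e1] at e4
  exact e3.symm.trans e4

/-- The stationary law of the Lindley recursion with negative drift. -/
theorem exists_stationary_lindley {W0 : Ω → ℝ} {X : ℕ → Ω → ℝ} (hW : Measurable W0)
    (hX : ∀ n, Measurable (X n)) (hind : iIndepFun X P)
    (hident : ∀ n, P.map (X n) = P.map (X 0))
    (hW0 : IndepFun W0 (fun ω n => X n ω) P) (hpos : ∀ᵐ ω ∂P, 0 ≤ W0 ω)
    (hint : Integrable (X 0) P) (hneg : ∫ ω, X 0 ω ∂P < 0) :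
    ∃ (π : Measure ℝ) (_ : IsProbabilityMeasure π) (_ : IsProbabilityMeasure (P.map (X 0))),
      (∀ᵐ x ∂π, 0 ≤ x) ∧
      TendstoInDistribution (fun n ω => (lindley (W0 ω) (fun i => X i ω) n, X n ω)) atTop id
        (fun _ => P) (π.prod (P.map (X 0))) ∧
      (π.prod (P.map (X 0))).map (fun q => max (q.1 + q.2) 0) = π := by
  have hν : IsProbabilityMeasure (P.map (X 0)) :=
    Measure.isProbabilityMeasure_map (hX 0).aemeasurable
  set ν := P.map (X 0) with hνdef
  have hXm : Measurable (fun ω n => X n ω) := measurable_pi_lambda _ hX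
  have hLm : ∀ n, Measurable fun ω => lindley (W0 ω) (fun i => X i ω) n := fun n =>
    (measurable_lindley n).comp (hW.prodMk hXm)
  -- `B n` has the law of the state at time `n + 1`, but unlike the states themselves it is shown to
  -- converge almost surely.
  let B : ℕ → Ω → ℝ := fun n ω => lindley (W0 ω) (fun i => X (n - i) ω) (n + 1)
  have hBm : ∀ n, Measurable (B n) := fun n =>
    (measurable_lindley (n + 1)).comp (hW.prodMk (measurable_pi_lambda _ fun i => hX (n - i)))
  have hBlaw : ∀ n, P.map (fun ω => lindley (W0 ω) (fun i => X i ω) (n + 1)) = P.map (B n) :=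
    map_lindley_reverse hW hX hind hident hW0
  have hslln := strong_law_ae_real X hint (fun i j hij => hind.indepFun hij) fun i =>
    ⟨(hX i).aemeasurable, (hX 0).aemeasurable, hident i⟩
  have hconv : ∀ᵐ ω ∂P, ∃ l, Tendsto (fun n => B n ω) atTop (nhds l) := by
    filter_upwards [hslln] with ω hω
    obtain ⟨l, hl⟩ := tendsto_reversed_lindley (w := W0 ω) (x := fun i => X i ω) hneg hω
    exact ⟨l, hl.congr fun n => (lindley_reverse (W0 ω) (fun i => X i ω) n).symm⟩
  obtain ⟨Winf, hWm, hWt⟩ := measurable_limit_of_tendsto_metrizable_ae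
    (fun n => (hBm n).aemeasurable) hconv
  have hπ : IsProbabilityMeasure (P.map Winf) :=
    Measure.isProbabilityMeasure_map hWm.aemeasurable
  -- The current increment is independent of the state, so the pair can be realised as `B n` with a
  -- fresh increment on a product space; almost sure convergence of `B n` then yields joint
  -- convergence in law.
  have hlaw : ∀ n, P.map (fun ω => (lindley (W0 ω) (fun i => X i ω) (n + 1), X (n + 1) ω))
      = (P.prod ν).map (fun q => (B n q.1, q.2)) := by
    intro n
    rw [(indepFun_iff_map_prod_eq_prod_map_map (hLm _).aemeasurable (hX _).aemeasurable).1
      (indepFun_lindley hW hX hind hW0 (n + 1)), hBlaw, hident (n + 1)]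
    have := Measure.map_prod_map P ν (hBm n) measurable_id
    rw [Measure.map_id] at this
    exact this
  have hlim : (P.prod ν).map (fun q => (Winf q.1, q.2)) = (P.map Winf).prod ν := by
    have := Measure.map_prod_map P ν hWm measurable_id
    rw [Measure.map_id] at this
    exact this.symm
  have hmB : ∀ n, Measurable (fun q : Ω × ℝ => (B n q.1, q.2)) := fun n =>
    ((hBm n).comp measurable_fst).prodMk measurable_snd
  have hmW : Measurable (fun q : Ω × ℝ => (Winf q.1, q.2)) :=
    (hWm.comp measurable_fst).prodMk measurable_snd
  have hD : TendstoInDistribution (fun n (q : Ω × ℝ) => (B n q.1, q.2)) atTop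
      (fun q => (Winf q.1, q.2)) (fun _ => P.prod ν) (P.prod ν) := by
    refine tendstoInDistribution_of_ae_tendsto (fun n => (hmB n).aemeasurable) hmW.aemeasurable ?_
    have : ∀ᵐ q ∂(P.prod ν), Tendsto (fun n => B n q.1) atTop (nhds (Winf q.1)) :=
      Measure.quasiMeasurePreserving_fst.ae hWt
    filter_upwards [this] with q hq
    exact hq.prodMk_nhds tendsto_const_nhds
  have hD' : TendstoInDistribution (fun n ω => (lindley (W0 ω) (fun i => X i ω) n, X n ω)) atTop id
        (fun _ => P) ((P.map Winf).prod ν) := by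
    refine ⟨fun n => ((hLm n).prodMk (hX n)).aemeasurable, measurable_id.aemeasurable, ?_⟩
    refine (tendsto_add_atTop_iff_nat 1).1 ?_
    have h := hD.tendsto
    refine le_trans (Tendsto.congr (fun n => Subtype.ext (hlaw n).symm) h)
      (le_of_eq (congrArg nhds (Subtype.ext ?_)))
    show _ = Measure.map id _
    rw [Measure.map_id, ← hlim]
  refine ⟨P.map Winf, hπ, hν, ?_, hD', ?_⟩
  · rw [ae_map_iff hWm.aemeasurable measurableSet_Ici]
    filter_upwards [hWt, hpos] with ω hω h0
    exact ge_of_tendsto' hω fun n => lindley_nonneg h0 _ _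
  · have h1 := hD'.continuous_comp (g := fun q : ℝ × ℝ => max (q.1 + q.2) 0) (by fun_prop)
    have h2 := hD'.continuous_comp (g := fun q : ℝ × ℝ => q.1) (by fun_prop)
    -- The image of the pair at time `n` is the state at time `n + 1`, a shift of the first
    -- coordinate. Uniqueness of limits in law gives invariance.
    have h2' : TendstoInDistribution (fun n ω => max (lindley (W0 ω) (fun i => X i ω) n + X n ω) 0)
        atTop ((fun q : ℝ × ℝ => q.1) ∘ id) (fun _ => P) ((P.map Winf).prod ν) :=
      ⟨fun n => (hLm (n + 1)).aemeasurable, h2.aemeasurable_limit,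
        h2.tendsto.comp (tendsto_add_atTop_nat 1)⟩
    have h3 := tendstoInDistribution_unique _ h1 h2'
    refine (show _ = _ from h3).trans ?_
    show Measure.map Prod.fst _ = _
    rw [Measure.map_fst_prod]; simp

end RandomWalk

/-! ### Overlap times along a sample path -/

section Overlap

variable {Ω : Type*} {W0 : Ω → ℝ} {S A : ℕ → Ω → ℝ} {ω : Ω}

lemma arrival_succ (n : ℕ) : arrival A (n + 1) ω = arrival A n ω + A n ω :=
  Finset.sum_range_succ _ _

lemma waiting_nonneg (h0 : 0 ≤ W0 ω) (n : ℕ) : 0 ≤ waiting W0 S A n ω := by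
  rw [waiting_eq_lindley]; exact lindley_nonneg h0 _ _

lemma monotone_arrival (hA : ∀ n, 0 ≤ A n ω) : Monotone fun n => arrival A n ω :=
  monotone_nat_of_le_succ fun n => by rw [arrival_succ]; linarith [hA n]

/-- From `W_{n+1} ≥ W_n + S_n - A_n`, customer `n + 1` departs at least `S_{n+1}` after customer
`n`. -/
lemma monotone_departure (hS : ∀ n, 0 ≤ S n ω) : Monotone fun n => departure W0 S A n ω :=
  monotone_nat_of_le_succ fun n => by
    have : waiting W0 S A n ω + S n ω - A n ω ≤ waiting W0 S A (n + 1) ω := le_max_left _ _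
    simp only [departure, arrival_succ]
    linarith [hS (n + 1)]

lemma overlap_comm (m n : ℕ) : overlap W0 S A m n ω = overlap W0 S A n m ω := by
  simp only [overlap, min_comm, max_comm]

lemma overlap_of_le (hS : ∀ n, 0 ≤ S n ω) (hA : ∀ n, 0 ≤ A n ω) {m n : ℕ} (h : m ≤ n) :
    overlap W0 S A m n ω = max (departure W0 S A m ω - arrival A n ω) 0 := by
  rw [overlap, min_eq_left (monotone_departure hS h), max_eq_right (monotone_arrival hA h)]

lemma overlap_succ (hS : ∀ n, 0 ≤ S n ω) (hA : ∀ n, 0 ≤ A n ω) (n : ℕ) :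
    overlap W0 S A n (n + 1) ω = waiting W0 S A (n + 1) ω := by
  rw [overlap_of_le hS hA n.le_succ]
  simp only [departure, arrival_succ, waiting]
  congr 1; ring

lemma maxOverlap_eq_max (h0 : 0 ≤ W0 ω) (n : ℕ) :
    maxOverlap W0 S A n ω = max (waiting W0 S A n ω) (waiting W0 S A (n + 1) ω) := by
  have := waiting_nonneg (S := S) (A := A) h0 n
  simp only [maxOverlap, waiting]
  rw [← max_assoc, max_eq_left (this.trans (le_max_left _ _)), ← max_add_add_left, max_comm]
  congr 1 <;> ring

/-- In a queue with nonnegative interarrival times the largest overlap of a customer is with one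
of the two adjacent customers. -/
lemma overlap_extremes (h0 : 0 ≤ W0 ω) (hS : ∀ n, 0 ≤ S n ω) (hA : ∀ n, 0 ≤ A n ω) {n : ℕ}
    (hn : 1 ≤ n) :
    IsGreatest {t : ℝ | ∃ m, m ≠ n ∧ t = overlap W0 S A n m ω} (maxOverlap W0 S A n ω) ∧
      minOverlap W0 S A n ω =
        min (overlap W0 S A n (n - 1) ω) (overlap W0 S A n (n + 1) ω) := by
  obtain ⟨k, rfl⟩ : ∃ k, n = k + 1 := ⟨n - 1, by omega⟩
  have e1 : overlap W0 S A (k + 1) k ω = waiting W0 S A (k + 1) ω := by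
    rw [overlap_comm, overlap_succ hS hA]
  have e2 : overlap W0 S A (k + 1) (k + 1 + 1) ω = waiting W0 S A (k + 1 + 1) ω :=
    overlap_succ hS hA _
  refine ⟨⟨?_, ?_⟩, ?_⟩
  · rw [maxOverlap_eq_max h0]
    rcases max_choice (waiting W0 S A (k + 1) ω) (waiting W0 S A (k + 1 + 1) ω) with h | h
    · exact ⟨k, by omega, by rw [h, e1]⟩
    · exact ⟨k + 1 + 1, by omega, by rw [h, e2]⟩
  · rintro t ⟨m, hm, rfl⟩
    rw [maxOverlap_eq_max h0]
    -- Among earlier customers the immediate predecessor departs last; among later ones the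
    -- immediate successor arrives first.
    rcases lt_or_gt_of_ne hm with h | h
    · refine le_trans ?_ (le_max_left _ _)
      rw [← e1, overlap_comm, overlap_comm (k + 1), overlap_of_le hS hA h.le,
        overlap_of_le hS hA k.le_succ]
      have := monotone_departure (W0 := W0) (A := A) hS (Nat.lt_succ_iff.1 h)
      exact max_le_max (sub_le_sub_right this _) le_rfl
    · refine le_trans ?_ (le_max_right _ _)
      rw [← e2, overlap_of_le hS hA h.le, overlap_of_le hS hA (k + 1).le_succ]
      have := monotone_arrival hA (Nat.succ_le_of_lt h)
      exact max_le_max (sub_le_sub_left this _) le_rfl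
  · rw [Nat.add_sub_cancel, e1, e2]; rfl

end Overlap

/-! ### The transforms on the real half-line: signs and behaviour at zero -/

/-- The transform `φ_S` at a real point, as a real number. -/
noncomputable def phiReal (f : ℝ → ℝ) (z : ℝ) : ℝ :=
  ∫ x, Real.exp (-(z * x)) ∂(lawOfDensity f)

/-- The transform `g*` at a real point, as a real number. -/
noncomputable def gReal (f : ℝ → ℝ) (z : ℝ) : ℝ :=
  ∫ x, (1 - 2 * cdf (lawOfDensity f) x) * Real.exp (-(z * x)) ∂(lawOfDensity f)

lemma phi_ofReal (f : ℝ → ℝ) (z : ℝ) : phi f z = phiReal f z := by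
  rw [phi, lst, phiReal, ← integral_complex_ofReal]
  refine integral_congr_ae (ae_of_all _ fun x => ?_)
  push_cast; ring_nf

lemma gStar_ofReal {f : ℝ → ℝ} (hfm : Measurable f) (hf0 : ∀ x, 0 ≤ f x) (z : ℝ) :
    gStar f z = gReal f z := by
  rw [gStar_eq_integral hfm hf0, gReal, ← integral_complex_ofReal]
  refine integral_congr_ae (ae_of_all _ fun x => ?_)
  push_cast; ring_nf

lemma integrable_id_lawOfDensity {f : ℝ → ℝ} (hfm : Measurable f) (hf0 : ∀ x, 0 ≤ f x)
    (hES : IntegrableOn (fun x => x * f x) (Set.Ioi 0)) :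
    Integrable (fun x => x) (lawOfDensity f) := by
  rw [lawOfDensity, integrable_withDensity_iff_integrable_smul₀' hfm.ennreal_ofReal.aemeasurable
    (ae_of_all _ fun _ => ENNReal.ofReal_lt_top)]
  refine hES.congr (ae_of_all _ fun x => ?_)
  simp [ENNReal.toReal_ofReal (hf0 x), mul_comm]

section Transforms

variable {f : ℝ → ℝ}

lemma ae_exp_le_one (f : ℝ → ℝ) {z : ℝ} (hz : 0 ≤ z) :
    ∀ᵐ x ∂(lawOfDensity f), Real.exp (-(z * x)) ≤ 1 := by
  filter_upwards [ae_pos_lawOfDensity f] with x hx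
  rw [Real.exp_le_one_iff]; have := mul_nonneg hz hx.le; linarith

lemma norm_mul_exp_le_one {k z x : ℝ} (hk : |k| ≤ 1) (hx : Real.exp (-(z * x)) ≤ 1) :
    ‖k * Real.exp (-(z * x))‖ ≤ 1 := by
  rw [norm_mul, Real.norm_eq_abs, Real.norm_of_nonneg (Real.exp_pos _).le]
  exact mul_le_one₀ hk (Real.exp_pos _).le hx

lemma phiReal_nonneg (z : ℝ) : 0 ≤ phiReal f z :=
  integral_nonneg fun _ => (Real.exp_pos _).le

variable [IsProbabilityMeasure (lawOfDensity f)]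

lemma integrable_mul_exp {k : ℝ → ℝ} (hk : Measurable k) (hk1 : ∀ x, |k x| ≤ 1) {z : ℝ}
    (hz : 0 ≤ z) : Integrable (fun x => k x * Real.exp (-(z * x))) (lawOfDensity f) :=
  Integrable.of_bound (by fun_prop : Measurable _).aestronglyMeasurable 1
    ((ae_exp_le_one f hz).mono fun x hx => norm_mul_exp_le_one (hk1 x) hx)

lemma continuousOn_integral_mul_exp {k : ℝ → ℝ} (hk : Measurable k) (hk1 : ∀ x, |k x| ≤ 1) :
    ContinuousOn (fun z => ∫ x, k x * Real.exp (-(z * x)) ∂(lawOfDensity f)) (Set.Ici 0) := by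
  refine continuousOn_of_dominated (bound := fun _ => 1)
    (fun z _ => (by fun_prop : Measurable _).aestronglyMeasurable)
    (fun z hz => (ae_exp_le_one f hz).mono fun x hx => norm_mul_exp_le_one (hk1 x) hx)
    (integrable_const _) (ae_of_all _ fun x => ?_)
  exact (by fun_prop : Continuous fun z => k x * Real.exp (-(z * x))).continuousOn

lemma measurable_gap (μ : Measure ℝ) : Measurable fun x => 1 - 2 * cdf μ x := by
  have := measurable_cdf μ
  fun_prop

lemma continuousOn_phiReal : ContinuousOn (phiReal f) (Set.Ici 0) := by
  have := continuousOn_integral_mul_exp (f := f) (k := fun _ => 1) measurable_const (by simp)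
  simp only [one_mul] at this
  exact this

lemma continuousOn_gReal : ContinuousOn (gReal f) (Set.Ici 0) :=
  continuousOn_integral_mul_exp (measurable_gap _) (abs_one_sub_two_cdf_le _)

lemma phiReal_zero : phiReal f 0 = 1 := by simp [phiReal]

lemma gReal_zero : gReal f 0 = 0 := by
  simpa [gReal] using integral_one_sub_two_cdf (lawOfDensity f)

lemma abs_gReal_le_one {z : ℝ} (hz : 0 ≤ z) : |gReal f z| ≤ 1 := by
  have := norm_integral_le_of_norm_le_const (μ := lawOfDensity f)
    ((ae_exp_le_one f hz).mono fun x hx =>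
      norm_mul_exp_le_one (abs_one_sub_two_cdf_le (lawOfDensity f) x) hx)
  simpa [gReal] using this

/-- At a point where `F = 1/2`, the integral of `1 - 2F` up to that point is `F (1 - F) = 1/4`, not
`0`. -/
lemma not_ae_cdf_eq_half : ¬ ∀ᵐ x ∂(lawOfDensity f), 1 - 2 * cdf (lawOfDensity f) x = 0 := by
  intro h
  obtain ⟨x, hx⟩ := h.exists
  have h1 := setIntegral_one_sub_two_cdf (lawOfDensity f) x
  rw [integral_eq_zero_of_ae (ae_restrict_of_ae h)] at h1
  have : cdf (lawOfDensity f) x = 1 / 2 := by linarith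
  rw [this] at h1; norm_num at h1

/-- A Chebyshev argument. The factor `1 - 2F` passes from positive to nonpositive at the median `c`
and integrates to zero, so `e^{-zc}` may be subtracted from the decreasing `e^{-zx}`; the two
factors then have compatible signs everywhere. -/
lemma gReal_pos {z : ℝ} (hz : 0 < z) : 0 < gReal f z := by
  set μ := lawOfDensity f with hμ
  obtain ⟨x1, hx1⟩ := ((tendsto_cdf_atTop μ).eventually (lt_mem_nhds (by norm_num :
    (1 / 2 : ℝ) < 1))).exists
  obtain ⟨x0, hx0⟩ := ((tendsto_cdf_atBot μ).eventually (gt_mem_nhds (by norm_num :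
    (0 : ℝ) < 1 / 2))).exists
  let U : Set ℝ := {x | 1 / 2 ≤ cdf μ x}
  have hUb : BddBelow U := ⟨x0, fun y hy => by
    by_contra hlt
    have := monotone_cdf μ (not_le.1 hlt).le
    have hy' : 1 / 2 ≤ cdf μ y := hy
    linarith⟩
  have hUn : U.Nonempty := ⟨x1, le_of_lt hx1⟩
  set c := sInf U
  have hlow : ∀ x < c, 0 < 1 - 2 * cdf μ x := fun x hx => by
    have : x ∉ U := fun h => not_le.2 hx (csInf_le hUb h)
    have : cdf μ x < 1 / 2 := not_le.1 this
    linarith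
  have hhigh : ∀ x, c < x → 1 - 2 * cdf μ x ≤ 0 := fun x hx => by
    obtain ⟨y, hy, hyx⟩ := exists_lt_of_csInf_lt hUn hx
    have h1 := monotone_cdf μ hyx.le
    have hy' : 1 / 2 ≤ cdf μ y := hy
    linarith
  have hi1 : Integrable (fun x => (1 - 2 * cdf μ x) * Real.exp (-(z * x))) μ :=
    integrable_mul_exp (measurable_gap _) (abs_one_sub_two_cdf_le _) hz.le
  have hi2 : Integrable (fun x => (1 - 2 * cdf μ x) * Real.exp (-(z * c))) μ :=
    ((integrable_const _).sub ((integrable_cdf μ μ).const_mul 2)).mul_const _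
  have heq : gReal f z
      = ∫ x, (1 - 2 * cdf μ x) * (Real.exp (-(z * x)) - Real.exp (-(z * c))) ∂μ := by
    simp only [mul_sub]
    rw [integral_sub hi1 hi2, integral_mul_const, integral_one_sub_two_cdf]
    simp [gReal, hμ]
  have hprod : ∀ x, 0 ≤ (1 - 2 * cdf μ x) * (Real.exp (-(z * x)) - Real.exp (-(z * c))) := by
    intro x
    rcases lt_trichotomy x c with h | h | h
    · refine mul_nonneg (hlow x h).le (sub_nonneg.2 (Real.exp_le_exp.2 ?_))
      nlinarith
    · simp [h]
    · refine mul_nonneg_of_nonpos_of_nonpos (hhigh x h) (sub_nonpos.2 (Real.exp_le_exp.2 ?_))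
      nlinarith
  have hi : Integrable (fun x => (1 - 2 * cdf μ x) *
      (Real.exp (-(z * x)) - Real.exp (-(z * c)))) μ := by
    simp only [mul_sub]; exact hi1.sub hi2
  rw [heq]
  refine lt_of_le_of_ne (integral_nonneg hprod) fun h0 => ?_
  have hz0 := (integral_eq_zero_iff_of_nonneg hprod hi).1 h0.symm
  refine not_ae_cdf_eq_half (f := f) ?_
  filter_upwards [hz0, (ae_iff.2 (by simp) : ∀ᵐ x ∂μ, x ≠ c)] with x hx hxc
  rcases mul_eq_zero.1 hx with h | h
  · exact h
  · have := Real.exp_injective (sub_eq_zero.1 h)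
    exact absurd (mul_left_cancel₀ hz.ne' (neg_injective this)) hxc

/-- The difference integrates `(1 - θ (1 - 2F)) e^{-zx} ≥ 0`. Equality would force `θ (1 - 2F) = 1`
almost everywhere, although `1 - 2F` has mean zero. -/
lemma theta_mul_gReal_lt_phiReal {θ z : ℝ} (hθ : |θ| ≤ 1) (hz : 0 ≤ z) :
    θ * gReal f z < phiReal f z := by
  set μ := lawOfDensity f with hμ
  have hi1 : Integrable (fun x => θ * ((1 - 2 * cdf μ x) * Real.exp (-(z * x)))) μ :=
    (integrable_mul_exp (measurable_gap _) (abs_one_sub_two_cdf_le _) hz).const_mul _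
  have hi2 : Integrable (fun x => Real.exp (-(z * x))) μ := by
    simpa using integrable_mul_exp (f := f) (k := fun _ => 1) measurable_const (by simp) hz
  have hnn : ∀ x, 0 ≤ Real.exp (-(z * x)) - θ * ((1 - 2 * cdf μ x) * Real.exp (-(z * x))) := by
    intro x
    have h := (abs_le.1 (abs_mul_mul_le_one hθ (abs_one_sub_two_cdf_le μ x)
      (by simp : |(1 : ℝ)| ≤ 1))).2
    have h2 := Real.exp_pos (-(z * x))
    nlinarith
  have heq : phiReal f z - θ * gReal f z
      = ∫ x, (Real.exp (-(z * x)) - θ * ((1 - 2 * cdf μ x) * Real.exp (-(z * x)))) ∂μ := by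
    rw [integral_sub hi2 hi1, integral_const_mul]; rfl
  rw [← sub_pos, heq]
  refine lt_of_le_of_ne (integral_nonneg hnn) fun h0 => ?_
  have hz0 := (integral_eq_zero_iff_of_nonneg hnn (hi2.sub hi1)).1 h0.symm
  have h1 : ∀ᵐ x ∂μ, θ * (1 - 2 * cdf μ x) = 1 := by
    filter_upwards [hz0] with x hx
    have h2 := Real.exp_pos (-(z * x))
    have h3 : (1 - θ * (1 - 2 * cdf μ x)) * Real.exp (-(z * x)) = 0 := by
      have : Real.exp (-(z * x)) - θ * ((1 - 2 * cdf μ x) * Real.exp (-(z * x))) = 0 := hx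
      linarith
    have := (mul_eq_zero.1 h3).resolve_right h2.ne'
    linarith
  have h2 := integral_congr_ae h1
  rw [integral_const_mul, integral_one_sub_two_cdf] at h2
  simp at h2

/-- Differentiation under the integral at `0`; the bound `1 - e^{-u} ≤ u` and the finite mean
provide the domination. -/
lemma tendsto_one_sub_phiReal_div (hfm : Measurable f) (hf0 : ∀ x, 0 ≤ f x)
    (hES : IntegrableOn (fun x => x * f x) (Set.Ioi 0)) {b : ℝ} (hb : 0 < b) :
    Tendsto (fun s => (1 - phiReal f (b * s)) / s) (nhdsWithin 0 (Set.Ioi 0))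
      (nhds (b * ∫ x in Set.Ioi (0 : ℝ), x * f x)) := by
  have hint := integrable_id_lawOfDensity hfm hf0 hES
  have hmean : ∫ x in Set.Ioi (0 : ℝ), x * f x = ∫ x, x ∂(lawOfDensity f) := by
    rw [integral_lawOfDensity hfm hf0]
    simp [mul_comm]
  rw [hmean, ← integral_const_mul]
  have heq : ∀ᶠ s in nhdsWithin (0 : ℝ) (Set.Ioi 0),
      ∫ x, (1 - Real.exp (-(b * s * x))) / s ∂(lawOfDensity f)
        = (1 - phiReal f (b * s)) / s := by
    filter_upwards [self_mem_nhdsWithin] with s hs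
    have hi2 : Integrable (fun x => Real.exp (-(b * s * x))) (lawOfDensity f) := by
      simpa using integrable_mul_exp (f := f) (k := fun _ => 1) measurable_const (by simp)
        (z := b * s) (mul_nonneg hb.le (le_of_lt hs))
    rw [integral_div, integral_sub (integrable_const _) hi2]
    simp [phiReal]
  refine Tendsto.congr' heq ?_
  refine tendsto_integral_filter_of_dominated_convergence (fun x => b * x)
    (Eventually.of_forall fun s => (by fun_prop : Measurable _).aestronglyMeasurable) ?_
    (hint.const_mul b) (ae_of_all _ fun x => ?_)
  · filter_upwards [self_mem_nhdsWithin] with s (hs : 0 < s)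
    filter_upwards [ae_pos_lawOfDensity f] with x hx
    have h1 := Real.add_one_le_exp (-(b * s * x))
    have h2 : Real.exp (-(b * s * x)) ≤ 1 := by
      rw [Real.exp_le_one_iff]; have := mul_nonneg (mul_nonneg hb.le hs.le) hx.le; linarith
    rw [Real.norm_of_nonneg (div_nonneg (by linarith) hs.le), div_le_iff₀ hs]
    nlinarith
  · have hd : HasDerivAt (fun s => Real.exp (-(b * s * x))) (-(b * x)) 0 := by
      have h1 : HasDerivAt (fun s => -(b * s * x)) (-(b * x)) 0 := by
        have := (((hasDerivAt_id (0 : ℝ)).const_mul b).mul_const x).neg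
        simp only [mul_one, id] at this
        exact this
      simpa using h1.exp
    have h2 := hd.tendsto_slope.mono_left (nhdsWithin_mono 0 (fun s (hs : 0 < s) => hs.ne'))
    have h3 := h2.neg
    rw [neg_neg] at h3
    refine h3.congr' ?_
    filter_upwards [self_mem_nhdsWithin] with s (hs : 0 < s)
    simp [slope_def_field]
    field_simp
    ring

end Transforms

/-! ### The kernel: positive zero and expansion at the origin -/

section Kernel

variable {N : ℕ} {lam θ : ℝ} {a p : Fin N → ℝ} {f : ℝ → ℝ}

/-- The mixture `∑ p_i φ_S((1 - a_i) s)` at a real point. -/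
noncomputable def mixPhi (a p : Fin N → ℝ) (f : ℝ → ℝ) (s : ℝ) : ℝ :=
  ∑ i, p i * phiReal f ((1 - a i) * s)

/-- The mixture `∑ p_i g*((1 - a_i) s)` at a real point. -/
noncomputable def mixG (a p : Fin N → ℝ) (f : ℝ → ℝ) (s : ℝ) : ℝ :=
  ∑ i, p i * gReal f ((1 - a i) * s)

/-- The factor `bracket` on the real axis, cleared of its denominators. -/
noncomputable def kernelReal (lam θ : ℝ) (a p : Fin N → ℝ) (f : ℝ → ℝ) (s : ℝ) : ℝ :=
  (lam - s) * (2 * lam - s) - lam * (2 * lam - s) * mixPhi a p f s + θ * s * lam * mixG a p f s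

lemma bracket_ofReal (hfm : Measurable f) (hf0 : ∀ x, 0 ≤ f x) {s : ℝ} (h1 : s ≠ lam)
    (h2 : s ≠ 2 * lam) :
    bracket lam θ a p f s = (kernelReal lam θ a p f s / ((lam - s) * (2 * lam - s)) : ℝ) := by
  have h1' : (lam : ℂ) - s ≠ 0 := by
    rw [← Complex.ofReal_sub, Complex.ofReal_ne_zero]; exact sub_ne_zero.2 h1.symm
  have h2' : 2 * (lam : ℂ) - s ≠ 0 := by
    have : 2 * lam - s ≠ 0 := sub_ne_zero.2 h2.symm
    exact_mod_cast this
  have e : bracket lam θ a p f s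
      = 1 - ((lam : ℂ) / (lam - s) * mixPhi a p f s
        - θ * (s * lam / ((lam - s) * (2 * lam - s))) * mixG a p f s) := by
    rw [bracket, mixPhi, mixG]
    push_cast
    rw [Finset.mul_sum, Finset.mul_sum, ← Finset.sum_sub_distrib]
    congr 1
    refine Finset.sum_congr rfl fun i _ => ?_
    rw [show (1 - (a i : ℂ)) * s = (((1 - a i) * s : ℝ) : ℂ) by push_cast; ring, phi_ofReal,
      gStar_ofReal hfm hf0]
    ring
  rw [e, kernelReal]
  push_cast
  have h2'' : (lam : ℂ) * 2 - s ≠ 0 := by rwa [mul_comm]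
  field_simp
  ring

/-- Isolates the two real constants `α` and `β` whose signs decide the zeros and the solvability of
the linear system. -/
lemma rhs_eq (hfm : Measurable f) (hf0 : ∀ x, 0 ≤ f x) (x y s : ℂ) :
    rhs lam θ a p f x y s = s * (((θ * mixG a p f lam - mixPhi a p f lam : ℝ) : ℂ) / (lam - s) * x
      - ((θ * mixG a p f (2 * lam) : ℝ) : ℂ) / (2 * lam - s) * y) := by
  rw [rhs, mixPhi, mixG, mixG]
  push_cast
  congr 1
  rw [Finset.mul_sum, Finset.mul_sum, ← Finset.sum_sub_distrib, Finset.sum_div, Finset.sum_div,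
    Finset.sum_mul, Finset.sum_mul, ← Finset.sum_sub_distrib]
  refine Finset.sum_congr rfl fun i _ => ?_
  rw [show (1 - (a i : ℂ)) * lam = (((1 - a i) * lam : ℝ) : ℂ) by push_cast; ring,
    show 2 * (1 - (a i : ℂ)) * lam = (((1 - a i) * (2 * lam) : ℝ) : ℂ) by push_cast; ring,
    phi_ofReal, gStar_ofReal hfm hf0, gStar_ofReal hfm hf0]
  ring

lemma zeroForm_eq (hfm : Measurable f) (hf0 : ∀ x, 0 ≤ f x) (x y : ℂ) :
    zeroForm lam θ a p f x y = 2 * ((θ * mixG a p f lam - mixPhi a p f lam : ℝ) : ℂ) * x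
      - ((θ * mixG a p f (2 * lam) : ℝ) : ℂ) * y := by
  rw [zeroForm, mixPhi, mixG, mixG]
  push_cast
  rw [Finset.mul_sum, Finset.mul_sum, ← Finset.sum_sub_distrib, Finset.mul_sum,
    Finset.sum_mul, Finset.sum_mul, ← Finset.sum_sub_distrib]
  refine Finset.sum_congr rfl fun i _ => ?_
  rw [show (1 - (a i : ℂ)) * lam = (((1 - a i) * lam : ℝ) : ℂ) by push_cast; ring,
    show 2 * (1 - (a i : ℂ)) * lam = (((1 - a i) * (2 * lam) : ℝ) : ℂ) by push_cast; ring,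
    phi_ofReal, gStar_ofReal hfm hf0, gStar_ofReal hfm hf0]
  ring

lemma exists_pos_weight (hp : ∀ i, 0 ≤ p i) (hp1 : ∑ i, p i = 1) : ∃ j, 0 < p j := by
  by_contra! h
  have : ∑ i, p i = 0 := Finset.sum_eq_zero fun i _ => le_antisymm (h i) (hp i)
  rw [this] at hp1; norm_num at hp1

lemma mixPhi_nonneg (hp : ∀ i, 0 ≤ p i) (s : ℝ) : 0 ≤ mixPhi a p f s :=
  Finset.sum_nonneg fun i _ => mul_nonneg (hp i) (phiReal_nonneg _)

variable [IsProbabilityMeasure (lawOfDensity f)]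

lemma mixG_pos (ha : ∀ i, a i < 1) (hp : ∀ i, 0 ≤ p i) (hp1 : ∑ i, p i = 1) {s : ℝ}
    (hs : 0 < s) : 0 < mixG a p f s := by
  obtain ⟨j, hj⟩ := exists_pos_weight hp hp1
  have hg : ∀ i, 0 < gReal f ((1 - a i) * s) := fun i => gReal_pos (mul_pos (sub_pos.2 (ha i)) hs)
  exact Finset.sum_pos' (fun i _ => mul_nonneg (hp i) (hg i).le)
    ⟨j, Finset.mem_univ j, mul_pos hj (hg j)⟩

lemma theta_mul_mixG_lt_mixPhi (hθ : |θ| ≤ 1) (ha : ∀ i, a i < 1) (hp : ∀ i, 0 ≤ p i)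
    (hp1 : ∑ i, p i = 1) {s : ℝ} (hs : 0 ≤ s) : θ * mixG a p f s < mixPhi a p f s := by
  obtain ⟨j, hj⟩ := exists_pos_weight hp hp1
  have hg : ∀ i, 0 < phiReal f ((1 - a i) * s) - θ * gReal f ((1 - a i) * s) := fun i =>
    sub_pos.2 (theta_mul_gReal_lt_phiReal hθ (mul_nonneg (sub_pos.2 (ha i)).le hs))
  have h := Finset.sum_pos' (fun i _ => mul_nonneg (hp i) (hg i).le)
    ⟨j, Finset.mem_univ j, mul_pos hj (hg j)⟩
  have e : mixPhi a p f s - θ * mixG a p f s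
      = ∑ i, p i * (phiReal f ((1 - a i) * s) - θ * gReal f ((1 - a i) * s)) := by
    rw [mixPhi, mixG, Finset.mul_sum, ← Finset.sum_sub_distrib]
    exact Finset.sum_congr rfl fun i _ => by ring
  linarith

lemma abs_mixG_le_one (ha : ∀ i, a i < 1) (hp : ∀ i, 0 ≤ p i)
    (hp1 : ∑ i, p i = 1) {s : ℝ} (hs : 0 ≤ s) : |mixG a p f s| ≤ 1 := by
  rw [← hp1]
  refine (Finset.abs_sum_le_sum_abs _ _).trans (Finset.sum_le_sum fun i _ => ?_)
  rw [abs_mul, abs_of_nonneg (hp i)]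
  exact mul_le_of_le_one_right (hp i)
    (abs_gReal_le_one (mul_nonneg (sub_pos.2 (ha i)).le hs))

lemma continuousOn_mixPhi (ha : ∀ i, a i < 1) : ContinuousOn (mixPhi a p f) (Set.Ici 0) := by
  refine continuousOn_finsetSum _ fun i _ => continuousOn_const.mul ?_
  exact continuousOn_phiReal.comp (by fun_prop) fun s hs =>
    mul_nonneg (sub_pos.2 (ha i)).le hs

lemma continuousOn_mixG (ha : ∀ i, a i < 1) : ContinuousOn (mixG a p f) (Set.Ici 0) := by
  refine continuousOn_finsetSum _ fun i _ => continuousOn_const.mul ?_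
  exact continuousOn_gReal.comp (by fun_prop) fun s hs =>
    mul_nonneg (sub_pos.2 (ha i)).le hs

lemma continuousOn_kernelReal (ha : ∀ i, a i < 1) :
    ContinuousOn (kernelReal lam θ a p f) (Set.Ici 0) := by
  have h1 := continuousOn_mixPhi (p := p) (f := f) ha
  have h2 := continuousOn_mixG (p := p) (f := f) ha
  unfold kernelReal
  fun_prop

/-- The positive zero of the kernel in the dependent case. -/
lemma exists_pos_zero_kernelReal (hlam : 0 < lam) (hθ : |θ| ≤ 1) (hθ0 : θ ≠ 0)
    (ha : ∀ i, a i < 1) (hp : ∀ i, 0 ≤ p i) (hp1 : ∑ i, p i = 1) :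
    ∃ t : ℝ, 0 < t ∧ t ≠ lam ∧ t ≠ 2 * lam ∧ kernelReal lam θ a p f t = 0 := by
  have hc := continuousOn_kernelReal (lam := lam) (θ := θ) (p := p) (f := f) ha
  have hG := mixG_pos (f := f) ha hp hp1 (by positivity : 0 < 2 * lam)
  have e2 : kernelReal lam θ a p f (2 * lam) = θ * (2 * lam ^ 2 * mixG a p f (2 * lam)) := by
    unfold kernelReal; ring
  have hpos : 0 < 2 * lam ^ 2 * mixG a p f (2 * lam) := by positivity
  -- At `2λ` the kernel has the sign of `θ`. For `θ < 0` it is positive at `4λ`, where `|θ G| ≤ 1`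
  -- suffices; for `θ > 0` it is negative at `λ`, because `θ G < Φ`. Open intervals keep the zero
  -- away from `λ` and `2λ`.
  rcases lt_or_gt_of_ne hθ0 with h | h
  · have hsub : Set.Icc (2 * lam) (4 * lam) ⊆ Set.Ici (0 : ℝ) := fun x hx =>
      le_trans (by positivity) hx.1
    have h2 : kernelReal lam θ a p f (2 * lam) < 0 := by
      rw [e2]; exact mul_neg_of_neg_of_pos h hpos
    have h4 : 0 < kernelReal lam θ a p f (4 * lam) := by
      have hb := abs_mixG_le_one (f := f) ha hp hp1 (by positivity : 0 ≤ 4 * lam)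
      have hb2 : |θ * mixG a p f (4 * lam)| ≤ 1 := by
        rw [abs_mul]; exact mul_le_one₀ hθ (abs_nonneg _) hb
      have hb3 := (abs_le.1 hb2).1
      have hb4 := mixPhi_nonneg (a := a) (f := f) hp (4 * lam)
      have e : kernelReal lam θ a p f (4 * lam) = lam ^ 2 *
          (6 + 2 * mixPhi a p f (4 * lam) + 4 * (θ * mixG a p f (4 * lam))) := by
        unfold kernelReal; ring
      rw [e]
      exact mul_pos (by positivity) (by linarith)
    obtain ⟨t, ht, ht0⟩ := intermediate_value_Ioo (by linarith) (hc.mono hsub) ⟨h2, h4⟩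
    exact ⟨t, by linarith [ht.1], by linarith [ht.1] |> fun h : lam < t => h.ne', ht.1.ne', ht0⟩
  · have hsub : Set.Icc lam (2 * lam) ⊆ Set.Ici (0 : ℝ) := fun x hx => le_trans hlam.le hx.1
    have h2 : 0 < kernelReal lam θ a p f (2 * lam) := by
      rw [e2]; exact mul_pos h hpos
    have h1 : kernelReal lam θ a p f lam < 0 := by
      have hb := theta_mul_mixG_lt_mixPhi (f := f) hθ ha hp hp1 hlam.le
      have e : kernelReal lam θ a p f lam
          = lam ^ 2 * (θ * mixG a p f lam - mixPhi a p f lam) := by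
        unfold kernelReal; ring
      rw [e]
      exact mul_neg_of_pos_of_neg (by positivity) (by linarith)
    obtain ⟨t, ht, ht0⟩ := intermediate_value_Ioo (by linarith) (hc.mono hsub) ⟨h1, h2⟩
    exact ⟨t, by linarith [ht.1], ht.1.ne', ht.2.ne, ht0⟩

lemma mixPhi_zero (hp1 : ∑ i, p i = 1) : mixPhi a p f 0 = 1 := by
  simp [mixPhi, phiReal_zero, hp1]

lemma mixG_zero : mixG a p f 0 = 0 := by simp [mixG, gReal_zero]

lemma tendsto_kernelReal_div (hfm : Measurable f) (hf0 : ∀ x, 0 ≤ f x)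
    (hES : IntegrableOn (fun x => x * f x) (Set.Ioi 0))
    (ha : ∀ i, a i < 1) (hp1 : ∑ i, p i = 1) :
    Tendsto (fun s => kernelReal lam θ a p f s / s) (nhdsWithin 0 (Set.Ioi 0))
      (nhds (-2 * lam * (1 - load lam a p f))) := by
  have h1 : Tendsto (fun s => (1 - mixPhi a p f s) / s) (nhdsWithin 0 (Set.Ioi 0))
      (nhds (∑ i, p i * ((1 - a i) * ∫ x in Set.Ioi (0 : ℝ), x * f x))) := by
    have e : ∀ s, (1 - mixPhi a p f s) / s
        = ∑ i, p i * ((1 - phiReal f ((1 - a i) * s)) / s) := by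
      intro s
      rw [mixPhi, ← hp1, ← Finset.sum_sub_distrib, Finset.sum_div]
      exact Finset.sum_congr rfl fun i _ => by rw [hp1]; ring
    simp_rw [e]
    exact tendsto_finsetSum _ fun i _ =>
      (tendsto_one_sub_phiReal_div hfm hf0 hES (sub_pos.2 (ha i))).const_mul _
  have hle : nhdsWithin (0 : ℝ) (Set.Ioi 0) ≤ nhdsWithin 0 (Set.Ici 0) :=
    nhdsWithin_mono _ Set.Ioi_subset_Ici_self
  have h2 : Tendsto (mixPhi a p f) (nhdsWithin 0 (Set.Ioi 0)) (nhds 1) := by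
    have := (continuousOn_mixPhi (p := p) (f := f) ha 0 Set.self_mem_Ici).tendsto.mono_left hle
    rwa [mixPhi_zero hp1] at this
  have h3 : Tendsto (mixG a p f) (nhdsWithin 0 (Set.Ioi 0)) (nhds 0) := by
    have := (continuousOn_mixG (p := p) (f := f) ha 0 Set.self_mem_Ici).tendsto.mono_left hle
    rwa [mixG_zero] at this
  have h4 : Tendsto (fun s : ℝ => s) (nhdsWithin 0 (Set.Ioi 0)) (nhds 0) := nhdsWithin_le_nhds
  -- For `s > 0` the quotient is `2λ² (1 - Φ)/s - 3λ + s + λΦ + θλG`, with `Φ`, `G` the two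
  -- mixtures.
  have h5 := ((((h1.const_mul (2 * lam ^ 2)).add_const (-3 * lam)).add h4).add
    (h2.const_mul lam)).add (h3.const_mul (θ * lam))
  have e : 2 * lam ^ 2 * ∑ i, p i * ((1 - a i) * ∫ x in Set.Ioi (0 : ℝ), x * f x) + -3 * lam + 0
      + lam * 1 + θ * lam * 0 = -2 * lam * (1 - load lam a p f) := by
    simp only [load, ← mul_assoc]; ring
  rw [← e]
  refine h5.congr' ?_
  filter_upwards [self_mem_nhdsWithin] with s (hs : 0 < s)
  unfold kernelReal
  field_simp
  ring

lemma bracket_zero (hfm : Measurable f) (hf0 : ∀ x, 0 ≤ f x) (hlam : 0 < lam)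
    (hp1 : ∑ i, p i = 1) : bracket lam θ a p f 0 = 0 := by
  have := bracket_ofReal (θ := θ) (a := a) (p := p) hfm hf0 hlam.ne
    (by positivity : 2 * lam ≠ 0).symm
  rw [Complex.ofReal_zero] at this
  rw [this, kernelReal, mixPhi_zero hp1]
  simp

lemma lst_zero (μ : Measure ℝ) [IsProbabilityMeasure μ] : lst μ 0 = 1 := by simp [lst]

lemma tendsto_lst_zero {μ : Measure ℝ} [IsProbabilityMeasure μ] (hμ : ∀ᵐ x ∂μ, 0 ≤ x) :
    Tendsto (fun s : ℝ => lst μ s) (nhdsWithin 0 (Set.Ioi 0)) (nhds 1) := by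
  rw [← lst_zero μ]
  refine tendsto_integral_filter_of_dominated_convergence (fun _ => 1)
    (Eventually.of_forall fun s => (by fun_prop : Measurable _).aestronglyMeasurable) ?_
    (integrable_const _) (ae_of_all _ fun x => ?_)
  · filter_upwards [self_mem_nhdsWithin] with s (hs : 0 < s)
    exact hμ.mono fun x hx => norm_cexp_neg_mul_le_one (by simpa using hs.le) hx
  · have : Continuous fun s : ℝ => Complex.exp (-(s : ℂ) * x) := by fun_prop
    have h := this.tendsto 0
    rw [Complex.ofReal_zero] at h
    exact h.mono_left nhdsWithin_le_nhds

/-- The normalisation `w*(0) = 1` in the functional equation. -/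
lemma zeroForm_of_functional_equation (hlam : 0 < lam) (hfm : Measurable f) (hf0 : ∀ x, 0 ≤ f x)
    (hES : IntegrableOn (fun x => x * f x) (Set.Ioi 0))
    (ha : ∀ i, a i < 1) (hp1 : ∑ i, p i = 1)
    {μ : Measure ℝ} [IsProbabilityMeasure μ] (hμ : ∀ᵐ x ∂μ, 0 ≤ x) {x y : ℂ}
    (h : ∀ s : ℂ, 0 ≤ s.re → s ≠ lam → s ≠ 2 * lam →
      lst μ s * bracket lam θ a p f s = rhs lam θ a p f x y s) :
    zeroForm lam θ a p f x y = -2 * (1 - load lam a p f) := by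
  have hl : Tendsto (fun s : ℝ => lst μ s * ((kernelReal lam θ a p f s / s : ℝ) : ℂ))
      (nhdsWithin 0 (Set.Ioi 0)) (nhds (1 * ((-2 * lam * (1 - load lam a p f) : ℝ) : ℂ))) :=
    (tendsto_lst_zero hμ).mul ((Complex.continuous_ofReal.tendsto _).comp
      (tendsto_kernelReal_div hfm hf0 hES ha hp1))
  set α := ((θ * mixG a p f lam - mixPhi a p f lam : ℝ) : ℂ) with hα
  set β := ((θ * mixG a p f (2 * lam) : ℝ) : ℂ) with hβ
  have hr : Tendsto (fun s : ℝ => (2 * lam - s : ℂ) * (α * x) - (lam - s : ℂ) * (β * y))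
      (nhdsWithin 0 (Set.Ioi 0)) (nhds ((2 * lam - (0 : ℝ) : ℂ) * (α * x)
        - (lam - (0 : ℝ) : ℂ) * (β * y))) :=
    ((by fun_prop : Continuous fun s : ℝ =>
      (2 * lam - s : ℂ) * (α * x) - (lam - s : ℂ) * (β * y)).tendsto 0).mono_left
      nhdsWithin_le_nhds
  -- The functional equation multiplied by `(λ - s)(2λ - s)/s`. Its limit at `0` is `λ` times the
  -- claim.
  have heq : ∀ᶠ s : ℝ in nhdsWithin 0 (Set.Ioi 0),
      lst μ s * ((kernelReal lam θ a p f s / s : ℝ) : ℂ)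
        = (2 * lam - s : ℂ) * (α * x) - (lam - s : ℂ) * (β * y) := by
    filter_upwards [self_mem_nhdsWithin, nhdsWithin_le_nhds (gt_mem_nhds hlam)]
      with s (hs : 0 < s) hsl
    have n1 : s ≠ lam := hsl.ne
    have n2 : s ≠ 2 * lam := by intro hh; linarith
    have h1' : (lam : ℂ) - s ≠ 0 := by
      rw [← Complex.ofReal_sub, Complex.ofReal_ne_zero]; exact sub_ne_zero.2 n1.symm
    have h2' : 2 * (lam : ℂ) - s ≠ 0 := by
      have : 2 * lam - s ≠ 0 := sub_ne_zero.2 n2.symm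
      exact_mod_cast this
    have hs' : (s : ℂ) ≠ 0 := by exact_mod_cast hs.ne'
    have hh := h s (by simpa using hs.le) (by exact_mod_cast n1) (by exact_mod_cast n2)
    rw [bracket_ofReal hfm hf0 n1 n2, rhs_eq hfm hf0, ← hα, ← hβ] at hh
    push_cast at hh ⊢
    have h2'' : (lam : ℂ) * 2 - s ≠ 0 := by rwa [mul_comm]
    field_simp at hh ⊢
    linear_combination hh
  have hu := tendsto_nhds_unique (hl.congr' heq) hr
  rw [zeroForm_eq hfm hf0, ← hα, ← hβ]
  have hl0 : (lam : ℂ) ≠ 0 := by exact_mod_cast hlam.ne'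
  push_cast at hu
  refine mul_left_cancel₀ hl0 ?_
  linear_combination -hu

end Kernel

/-- The zeros of the kernel are read off from the functional equation. -/
lemma kernel_zeros {lam α β r : ℝ} (hlam : 0 < lam) (hr : r < 1)
    {K w : ℂ → ℂ} {x y : ℂ}
    (hfe : ∀ s : ℂ, 0 ≤ s.re → s ≠ lam → s ≠ 2 * lam →
      w s * K s = s * (α / (lam - s) * x - β / (2 * lam - s) * y))
    (hz : 2 * (α : ℂ) * x - β * y = -2 * (1 - r)) {s t : ℂ} (hs : 0 ≤ s.re) (hs1 : s ≠ lam)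
    (hs2 : s ≠ 2 * lam) (hs0 : s ≠ 0) (hK : K s = 0)
    (ht : (2 * lam - t) * (α * x) - (lam - t) * (β * y) = 0) : s = t := by
  have h1 : (lam : ℂ) - s ≠ 0 := sub_ne_zero.2 hs1.symm
  have h2 : 2 * (lam : ℂ) - s ≠ 0 := sub_ne_zero.2 hs2.symm
  have h := hfe s hs hs1 hs2
  rw [hK, mul_zero] at h
  have h3 := (mul_eq_zero.1 h.symm).resolve_left hs0
  have h4 : (2 * lam - s) * (α * x) - (lam - s) * (β * y) = 0 := by
    have h2'' : (lam : ℂ) * 2 - s ≠ 0 := by rwa [mul_comm]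
    field_simp at h3
    linear_combination h3
  have hl0 : (lam : ℂ) ≠ 0 := by exact_mod_cast hlam.ne'
  have hr0 : (1 : ℂ) - r ≠ 0 := by
    have : 1 - r ≠ 0 := by linarith
    exact_mod_cast this
  -- Two distinct roots of an affine function kill its slope, so `αx = βy`; the value at `s` then
  -- gives `λαx = 0`, and `hz` would yield `ρ = 1`.
  by_contra hne
  have h5 : (s - t) * (α * x - β * y) = 0 := by linear_combination ht - h4
  have h6 := (mul_eq_zero.1 h5).resolve_left (sub_ne_zero.2 hne)
  have h7 : (lam : ℂ) * (α * x) = 0 := by linear_combination h4 - (lam - s) * h6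
  have h8 := (mul_eq_zero.1 h7).resolve_left hl0
  have h9 : (1 : ℂ) - r = 0 := by linear_combination (1 / 2) * (hz - h6 - h8)
  exact hr0 h9

lemma TendstoInDistribution.continuous_comp_id {Ω E F : Type*} [MeasurableSpace Ω]
    [TopologicalSpace E] [MeasurableSpace E] [OpensMeasurableSpace E] [TopologicalSpace F]
    [MeasurableSpace F] [BorelSpace F] {P : Measure Ω} [IsProbabilityMeasure P]
    {X : ℕ → Ω → E} {ρ : Measure E} [IsProbabilityMeasure ρ] {ρ' : Measure F}
    [IsProbabilityMeasure ρ'] (h : TendstoInDistribution X atTop id (fun _ => P) ρ) {g : E → F}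
    (hg : Continuous g) (hρ : ρ.map g = ρ') :
    TendstoInDistribution (fun n ω => g (X n ω)) atTop id (fun _ => P) ρ' := by
  have h' := h.continuous_comp hg
  refine ⟨h'.forall_aemeasurable, measurable_id.aemeasurable, ?_⟩
  refine le_trans h'.tendsto (le_of_eq (congrArg nhds (Subtype.ext ?_)))
  show ρ.map (g ∘ id) = ρ'.map id
  rw [Measure.map_id, ← hρ]
  rfl

/-! ### Transforms under the stationary law -/

section Stationary

variable {π ν : Measure ℝ} [IsProbabilityMeasure π] [IsProbabilityMeasure ν]

lemma lst_map {E : Type*} [MeasurableSpace E] {ρ : Measure E} {g : E → ℝ} (hg : Measurable g)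
    (s : ℂ) : lst (ρ.map g) s = ∫ q, Complex.exp (-s * (g q : ℂ)) ∂ρ := by
  rw [lst, integral_map hg.aemeasurable (by fun_prop : Measurable _).aestronglyMeasurable]

lemma integrable_cexp_comp {E : Type*} [MeasurableSpace E] {ρ : Measure E} [IsFiniteMeasure ρ]
    {g : E → ℝ} (hg : Measurable g) (h0 : ∀ᵐ q ∂ρ, 0 ≤ g q) {s : ℂ} (hs : 0 ≤ s.re) :
    Integrable (fun q => Complex.exp (-s * (g q : ℂ))) ρ :=
  Integrable.of_bound (by fun_prop : Measurable _).aestronglyMeasurable 1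
    (h0.mono fun _ hx => norm_cexp_neg_mul_le_one hs hx)

lemma lst_stationary
    (hinv : (π.prod ν).map (fun q => max (q.1 + q.2) 0) = π) {s : ℂ} (hs : 0 ≤ s.re) :
    lst π s = ∫ w, ∫ x, Complex.exp (-s * ((max (w + x) 0 : ℝ) : ℂ)) ∂ν ∂π := by
  have hm : Measurable fun q : ℝ × ℝ => max (q.1 + q.2) 0 := by fun_prop
  conv_lhs => rw [← hinv]
  rw [lst_map hm, integral_prod _ (integrable_cexp_comp hm (ae_of_all _ fun q => le_max_right _ _)
    hs)]

lemma lst_max_overlap (s : ℂ) :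
    lst ((π.prod ν).map (fun q => q.1 + max q.2 0)) s
      = lst π s * ∫ x, Complex.exp (-s * ((max x 0 : ℝ) : ℂ)) ∂ν := by
  have hm : Measurable fun q : ℝ × ℝ => q.1 + max q.2 0 := by fun_prop
  rw [lst_map hm, lst, ← integral_prod_mul]
  refine integral_congr_ae (ae_of_all _ fun q => ?_)
  simp only
  rw [← Complex.exp_add]; push_cast; ring_nf

/-- For `w ≥ 0` the numbers `min w [w + x]⁺` and `w + x⁺` are `w` and `[w + x]⁺` in some order, and
both of the latter have law `π`. -/
lemma lst_min_overlap (hπ : ∀ᵐ x ∂π, 0 ≤ x)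
    (hinv : (π.prod ν).map (fun q => max (q.1 + q.2) 0) = π) {s : ℂ} (hs : 0 ≤ s.re) :
    lst ((π.prod ν).map (fun q => min q.1 (max (q.1 + q.2) 0))) s
      = 2 * lst π s - lst ((π.prod ν).map (fun q => q.1 + max q.2 0)) s := by
  have hm1 : Measurable fun q : ℝ × ℝ => q.1 + max q.2 0 := by fun_prop
  have hm2 : Measurable fun q : ℝ × ℝ => min q.1 (max (q.1 + q.2) 0) := by fun_prop
  have hm3 : Measurable fun q : ℝ × ℝ => max (q.1 + q.2) 0 := by fun_prop
  have hq : ∀ᵐ q ∂(π.prod ν), 0 ≤ q.1 := Measure.quasiMeasurePreserving_fst.ae hπ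
  have i1 := integrable_cexp_comp hm1 (hq.mono fun q h => add_nonneg h (le_max_right _ _)) hs
  have i2 := integrable_cexp_comp hm2 (hq.mono fun q h => le_min h (le_max_right _ _)) hs
  have i3 := integrable_cexp_comp hm3 (ae_of_all (π.prod ν) fun q => le_max_right _ _) hs
  have i4 := integrable_cexp_comp measurable_fst hq hs
  have e3 : lst π s = ∫ q, Complex.exp (-s * ((max (q.1 + q.2) 0 : ℝ) : ℂ)) ∂(π.prod ν) := by
    rw [← lst_map hm3, hinv]
  have e4 : lst π s = ∫ q, Complex.exp (-s * (q.1 : ℂ)) ∂(π.prod ν) := by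
    rw [← lst_map measurable_fst, Measure.map_fst_prod]; simp
  rw [lst_map hm1, lst_map hm2, eq_sub_iff_add_eq, ← integral_add i2 i1, two_mul]
  conv_rhs =>
    congr
    · rw [e4]
    · rw [e3]
  rw [← integral_add i4 i3]
  refine integral_congr_ae (hq.mono fun q h => ?_)
  simp only
  rcases le_total 0 q.2 with h2 | h2
  · rw [max_eq_left h2, max_eq_left (add_nonneg h h2), min_eq_left (by linarith)]
  · rw [max_eq_right h2, add_zero, min_eq_right (max_le (by linarith) h), add_comm]

end Stationary

/-! ### Mean of an increment and law of a triple -/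

lemma integral_id_expMeasure {r : ℝ} (hr : 0 < r) : ∫ y, y ∂(expMeasure r) = 1 / r := by
  have h := integral_expMeasure hr (fun y => (y : ℂ))
  have h2 : ∀ y ∈ Set.Ioi (0 : ℝ), (r * Complex.exp (-r * y)) * (y : ℂ)
      = ((r * (y ^ ((2 : ℝ) - 1) * Real.exp (-(r * y))) : ℝ) : ℂ) := by
    intro y _
    rw [show (2 : ℝ) - 1 = 1 by norm_num, Real.rpow_one]
    push_cast; ring_nf
  rw [setIntegral_congr_fun measurableSet_Ioi h2, integral_complex_ofReal,
    integral_complex_ofReal, integral_const_mul,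
    Real.integral_rpow_mul_exp_neg_mul_Ioi (by norm_num) hr] at h
  have h3 := Complex.ofReal_injective h
  rw [h3, show (2 : ℝ) = (1 : ℕ) + 1 by norm_num, Real.Gamma_nat_eq_factorial]
  rw [show ((1 : ℕ) : ℝ) + 1 = ((2 : ℕ) : ℝ) by norm_num, Real.rpow_natCast]
  simp
  field_simp

lemma ae_nonneg_expMeasure (r : ℝ) : ∀ᵐ y ∂(expMeasure r), 0 ≤ y := by
  rw [ae_iff]
  have : {y : ℝ | ¬ 0 ≤ y} = Set.Iio 0 := by ext; simp
  rw [this]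
  show volume.withDensity (exponentialPDF r) (Set.Iio 0) = 0
  rw [withDensity_apply _ measurableSet_Iio]
  exact lintegral_exponentialPDF_of_nonpos le_rfl

lemma ae_sum_smul_dirac {N : ℕ} {a p : Fin N → ℝ} {Q : ℝ → Prop} (hQ : ∀ i, Q (a i)) :
    ∀ᵐ x ∂(∑ i, ENNReal.ofReal (p i) • Measure.dirac (a i)), Q x := by
  rw [← Measure.sum_fintype]
  exact Measure.ae_sum_iff.2 fun i => Measure.ae_smul_measure (by simp [ae_dirac_eq, hQ i]) _

lemma integral_id_sum_smul_dirac {N : ℕ} {a p : Fin N → ℝ} (hp : ∀ i, 0 ≤ p i) :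
    ∫ x, x ∂(∑ i, ENNReal.ofReal (p i) • Measure.dirac (a i)) = ∑ i, p i * a i := by
  rw [integral_finsetSum_measure fun i _ =>
    (integrable_dirac (by simp)).smul_measure ENNReal.ofReal_ne_top]
  exact Finset.sum_congr rfl fun i _ => by
    rw [integral_smul_measure, integral_dirac, ENNReal.toReal_ofReal (hp i), smul_eq_mul]

section Increment

variable {Ω : Type*} [MeasurableSpace Ω] {P : Measure Ω} [IsProbabilityMeasure P]
  {N : ℕ} {lam θ : ℝ} {a p : Fin N → ℝ} {f : ℝ → ℝ} {S J Om : Ω → ℝ}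

/-- One increment of the random walk is integrable, and its mean is `(ρ - 1) / λ`. -/
lemma increment_mean (hlam : 0 < lam) (hp : ∀ i, 0 ≤ p i) (hp1 : ∑ i, p i = 1)
    (hfm : Measurable f) (hf0 : ∀ x, 0 ≤ f x)
    (hSm : Measurable S) (hJm : Measurable J) (hOm : Measurable Om)
    (hS : P.map S = lawOfDensity f) (hJ : P.map J = expMeasure lam)
    (hOmlaw : P.map Om = ∑ i, ENNReal.ofReal (p i) • Measure.dirac (a i))
    (hOmind : IndepFun Om (fun ω => (S ω, J ω)) P)
    (hES : IntegrableOn (fun x => x * f x) (Set.Ioi 0)) :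
    Integrable (fun ω => S ω - (Om ω * S ω + J ω)) P ∧
      ∫ ω, (S ω - (Om ω * S ω + J ω)) ∂P = (load lam a p f - 1) / lam := by
  have hind : IndepFun Om S P := hOmind.comp measurable_id measurable_fst
  have hSi : Integrable S P := by
    have := integrable_id_lawOfDensity hfm hf0 hES
    rw [← hS] at this
    exact (integrable_map_measure measurable_id.aestronglyMeasurable hSm.aemeasurable).1 this
  have hSe : ∫ ω, S ω ∂P = ∫ x in Set.Ioi (0 : ℝ), x * f x := by
    have : ∫ x, x ∂(P.map S) = ∫ ω, S ω ∂P :=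
      integral_map hSm.aemeasurable measurable_id.aestronglyMeasurable
    rw [← this, hS, integral_lawOfDensity hfm hf0]
    simp [mul_comm]
  have hJe : ∫ ω, J ω ∂P = 1 / lam := by
    have : ∫ x, x ∂(P.map J) = ∫ ω, J ω ∂P :=
      integral_map hJm.aemeasurable measurable_id.aestronglyMeasurable
    rw [← this, hJ, integral_id_expMeasure hlam]
  have hJi : Integrable J P := by
    -- The integral of a nonintegrable function is `0` by convention, so a nonzero mean certifies
    -- integrability.
    refine .of_integral_ne_zero ?_
    rw [hJe]; positivity
  have hOe : ∫ ω, Om ω ∂P = ∑ i, p i * a i := by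
    have : ∫ x, x ∂(P.map Om) = ∫ ω, Om ω ∂P :=
      integral_map hOm.aemeasurable measurable_id.aestronglyMeasurable
    rw [← this, hOmlaw, integral_id_sum_smul_dirac hp]
  have hOi : Integrable Om P := by
    refine Integrable.of_bound hOm.aestronglyMeasurable (∑ i, |a i|) ?_
    refine ae_of_ae_map (p := fun x => ‖x‖ ≤ ∑ i, |a i|) hOm.aemeasurable ?_
    rw [hOmlaw]
    exact ae_sum_smul_dirac fun i =>
      Finset.single_le_sum (f := fun i => |a i|) (fun _ _ => abs_nonneg _) (Finset.mem_univ i)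
  have hOSi : Integrable (fun ω => Om ω * S ω) P := hind.integrable_mul hOi hSi
  have hOSe : ∫ ω, Om ω * S ω ∂P = (∫ ω, Om ω ∂P) * ∫ ω, S ω ∂P :=
    hind.integral_fun_mul_eq_mul_integral hOm.aestronglyMeasurable hSm.aestronglyMeasurable
  refine ⟨hSi.sub (hOSi.add hJi), ?_⟩
  rw [integral_sub hSi (by exact hOSi.add hJi), integral_add hOSi hJi, hOSe, hOe, hJe, hSe, load,
    ← Finset.sum_mul]
  have : ∑ i, p i * (1 - a i) = 1 - ∑ i, p i * a i := by
    rw [← hp1, ← Finset.sum_sub_distrib]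
    exact Finset.sum_congr rfl fun i _ => by rw [hp1]; ring
  rw [this]
  field_simp
  ring

/-- The law of a triple of the model is determined by its parameters. -/
lemma map_triple (hlam : 0 < lam) (hθ : |θ| ≤ 1) [IsProbabilityMeasure (lawOfDensity f)]
    (hSm : Measurable S) (hJm : Measurable J) (hOm : Measurable Om)
    (hS : P.map S = lawOfDensity f) (hJ : P.map J = expMeasure lam)
    (hOmlaw : P.map Om = ∑ i, ENNReal.ofReal (p i) • Measure.dirac (a i))
    (hSJ : ∀ x y, P.real {ω | S ω ≤ x ∧ J ω ≤ y} =
      fgmCopula θ (cdf (P.map S) x) (cdf (P.map J) y))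
    (hOmind : IndepFun Om (fun ω => (S ω, J ω)) P) :
    P.map (fun ω => (Om ω, S ω, J ω)) =
      (∑ i, ENNReal.ofReal (p i) • Measure.dirac (a i)).prod
        (((lawOfDensity f).prod (expMeasure lam)).withDensity
          (fun q => ENNReal.ofReal (fgmDensity θ (lawOfDensity f) (expMeasure lam) q))) := by
  have := isProbabilityMeasure_expMeasure hlam
  have hpm : IsProbabilityMeasure (P.map fun ω => (S ω, J ω)) :=
    Measure.isProbabilityMeasure_map (hSm.prodMk hJm).aemeasurable
  rw [(indepFun_iff_map_prod_eq_prod_map_map hOm.aemeasurable (hSm.prodMk hJm).aemeasurable).1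
    hOmind, hOmlaw, eq_withDensity_fgmDensity hθ (lawOfDensity f) (expMeasure lam)
      (P.map fun ω => (S ω, J ω)) fun x y => ?_]
  rw [← hS, ← hJ, ← hSJ, map_measureReal_apply (hSm.prodMk hJm)
    (measurableSet_Iic.prod measurableSet_Iic)]
  rfl

end Increment

end FGMQueue

/-! ### Assembly of the main theorem -/

theorem mainTheorem7 {Ω : Type*} [MeasurableSpace Ω] (P : Measure Ω) [IsProbabilityMeasure P]
    {N : ℕ} (lam θ : ℝ) (a p : Fin N → ℝ) (f : ℝ → ℝ)
    (W0 : Ω → ℝ) (S J Om : ℕ → Ω → ℝ)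
    (hlam : 0 < lam) (hθ : θ ∈ Set.Icc (-1 : ℝ) 1)
    (ha : ∀ i, a i < 1) (hp : ∀ i, 0 ≤ p i) (hp1 : ∑ i, p i = 1)
    (hfm : Measurable f) (hf0 : ∀ x, 0 ≤ f x)
    (hW0m : Measurable W0) (hSm : ∀ n, Measurable (S n)) (hJm : ∀ n, Measurable (J n))
    (hOm : ∀ n, Measurable (Om n))
    -- the marginal laws
    (hW0 : ∀ᵐ ω ∂P, 0 ≤ W0 ω)
    (hS : ∀ n, P.map (S n) = FGMQueue.lawOfDensity f)
    (hJ : ∀ n, P.map (J n) = expMeasure lam)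
    (hOmlaw : ∀ n, P.map (Om n) = ∑ i, ENNReal.ofReal (p i) • Measure.dirac (a i))
    -- the joint law of `(S_n, J_n)`
    (hSJ : ∀ n x y, P.real {ω | S n ω ≤ x ∧ J n ω ≤ y} =
      FGMQueue.fgmCopula θ (cdf (P.map (S n)) x) (cdf (P.map (J n)) y))
    -- the independence assumptions
    (hOmind : ∀ n, IndepFun (Om n) (fun ω => (S n ω, J n ω)) P)
    (hiid : iIndepFun (fun n ω => (Om n ω, S n ω, J n ω)) P)
    (hW0ind : IndepFun W0 (fun ω n => (Om n ω, S n ω, J n ω)) P)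
    -- stability
    (hES : IntegrableOn (fun x => x * f x) (Set.Ioi 0))
    (hstab : FGMQueue.load lam a p f < 1) :
    ∃ μW μM μV : ProbabilityMeasure ℝ,
      -- the steady state exists
      TendstoInDistribution (FGMQueue.waiting W0 S (FGMQueue.interarrival Om S J))
        atTop id (fun _ => P) (μW : Measure ℝ) ∧
      TendstoInDistribution (FGMQueue.maxOverlap W0 S (FGMQueue.interarrival Om S J))
        atTop id (fun _ => P) (μM : Measure ℝ) ∧
      TendstoInDistribution (FGMQueue.minOverlap W0 S (FGMQueue.interarrival Om S J))
        atTop id (fun _ => P) (μV : Measure ℝ) ∧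
      (∀ᵐ x ∂(μW : Measure ℝ), 0 ≤ x) ∧ (∀ᵐ x ∂(μM : Measure ℝ), 0 ≤ x) ∧
      (∀ᵐ x ∂(μV : Measure ℝ), 0 ≤ x) ∧
      -- the functional equation of the waiting-time transform
      (∀ s : ℂ, 0 ≤ s.re → s ≠ lam → s ≠ 2 * lam →
        FGMQueue.lst μW s * FGMQueue.bracket lam θ a p f s =
          FGMQueue.rhs lam θ a p f (FGMQueue.lst μW lam) (FGMQueue.lst μW (2 * lam)) s) ∧
      -- the equation that comes from `w*(0) = 1`
      FGMQueue.lst μW 0 = 1 ∧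
      FGMQueue.zeroForm lam θ a p f (FGMQueue.lst μW lam) (FGMQueue.lst μW (2 * lam)) =
        -2 * (1 - FGMQueue.load lam a p f) ∧
      -- the zeros of the bracket, and the determination of the two unknowns
      (θ ≠ 0 → ∃ τ : ℂ, 0 < τ.re ∧ τ ≠ lam ∧ τ ≠ 2 * lam ∧
        (∀ s : ℂ, 0 ≤ s.re → s ≠ lam → s ≠ 2 * lam →
          (FGMQueue.bracket lam θ a p f s = 0 ↔ s = τ ∨ s = 0)) ∧
        (∀ x y : ℂ,
          (FGMQueue.zeroForm lam θ a p f x y = -2 * (1 - FGMQueue.load lam a p f) ∧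
            FGMQueue.rhs lam θ a p f x y τ = 0) ↔
          (x = FGMQueue.lst μW lam ∧ y = FGMQueue.lst μW (2 * lam)))) ∧
      (θ = 0 →
        (∀ s : ℂ, 0 ≤ s.re → s ≠ lam → s ≠ 2 * lam →
          (FGMQueue.bracket lam θ a p f s = 0 ↔ s = 0)) ∧
        (∀ x y : ℂ,
          FGMQueue.zeroForm lam θ a p f x y = -2 * (1 - FGMQueue.load lam a p f) ↔
            x = FGMQueue.lst μW lam)) ∧
      -- the transforms of the maximum and of the minimum overlap time
      (∀ s : ℂ, 0 ≤ s.re → s ≠ lam → s ≠ 2 * lam →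
        FGMQueue.lst μM s = FGMQueue.lst μW s * FGMQueue.maxFactor lam θ a p f s) ∧
      (∀ s : ℂ, 0 ≤ s.re → s ≠ lam → s ≠ 2 * lam →
        FGMQueue.lst μV s = FGMQueue.lst μW s * FGMQueue.minFactor lam θ a p f s) ∧
      -- `M_n` is the longest overlap of customer `n` with another customer, and `V_n` the shorter
      -- overlap with the two adjacent customers, when the interarrival times are nonnegative
      ((∀ i, 0 ≤ a i) → ∀ᵐ ω ∂P, ∀ n, 1 ≤ n →
        IsGreatest {t : ℝ | ∃ m, m ≠ n ∧
            t = FGMQueue.overlap W0 S (FGMQueue.interarrival Om S J) n m ω}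
          (FGMQueue.maxOverlap W0 S (FGMQueue.interarrival Om S J) n ω) ∧
        FGMQueue.minOverlap W0 S (FGMQueue.interarrival Om S J) n ω =
          min (FGMQueue.overlap W0 S (FGMQueue.interarrival Om S J) n (n - 1) ω)
            (FGMQueue.overlap W0 S (FGMQueue.interarrival Om S J) n (n + 1) ω)) := by
  have hθ' : |θ| ≤ 1 := abs_le.2 hθ
  have hpS : IsProbabilityMeasure (FGMQueue.lawOfDensity f) := by
    rw [← hS 0]; exact Measure.isProbabilityMeasure_map (hSm 0).aemeasurable
  set A := FGMQueue.interarrival Om S J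
  let X : ℕ → Ω → ℝ := fun n ω => S n ω - A n ω
  have hinc : Measurable fun q : ℝ × ℝ × ℝ => q.2.1 - (q.1 * q.2.1 + q.2.2) := by fun_prop
  have htm : ∀ n, Measurable fun ω => (Om n ω, S n ω, J n ω) := fun n =>
    (hOm n).prodMk ((hSm n).prodMk (hJm n))
  have hXm : ∀ n, Measurable (X n) := fun n => hinc.comp (htm n)
  have hXind : iIndepFun X P :=
    hiid.comp (fun _ q => q.2.1 - (q.1 * q.2.1 + q.2.2)) fun _ => hinc
  -- `hiid` supplies only independence; equality of the laws follows since marginals, copula and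
  -- mixing law determine the law of a triple.
  have hXid : ∀ n, P.map (X n) = P.map (X 0) := by
    intro n
    have e : ∀ n, P.map (X n)
        = (P.map fun ω => (Om n ω, S n ω, J n ω)).map
          (fun q : ℝ × ℝ × ℝ => q.2.1 - (q.1 * q.2.1 + q.2.2)) := fun n =>
      (Measure.map_map hinc (htm n)).symm
    rw [e, e, FGMQueue.map_triple hlam hθ' (hSm n) (hJm n) (hOm n) (hS n) (hJ n) (hOmlaw n)
      (hSJ n) (hOmind n), FGMQueue.map_triple hlam hθ' (hSm 0) (hJm 0) (hOm 0) (hS 0) (hJ 0)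
      (hOmlaw 0) (hSJ 0) (hOmind 0)]
  have hXW : IndepFun W0 (fun ω n => X n ω) P :=
    hW0ind.comp (ψ := fun (q : ℕ → ℝ × ℝ × ℝ) n =>
      (q n).2.1 - ((q n).1 * (q n).2.1 + (q n).2.2)) measurable_id
      (measurable_pi_lambda _ fun n => hinc.comp (measurable_pi_apply n))
  obtain ⟨hXi, hXe⟩ := FGMQueue.increment_mean hlam hp hp1 hfm hf0 (hSm 0) (hJm 0) (hOm 0) (hS 0)
    (hJ 0) (hOmlaw 0) (hOmind 0) hES
  have hneg : ∫ ω, X 0 ω ∂P < 0 := by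
    refine lt_of_eq_of_lt hXe (div_neg_of_neg_of_pos (by linarith) hlam)
  obtain ⟨π, hπ, hν, hπ0, hD, hinv⟩ := FGMQueue.exists_stationary_lindley hW0m hXm hXind hXid hXW
    hW0 hXi hneg
  set ν := P.map (X 0) with hνdef
  have hcont : Continuous fun q : ℝ × ℝ => q.1 + max q.2 0 := by fun_prop
  have hcont2 : Continuous fun q : ℝ × ℝ => min q.1 (max (q.1 + q.2) 0) := by fun_prop
  have hpM : IsProbabilityMeasure ((π.prod ν).map fun q => q.1 + max q.2 0) :=
    Measure.isProbabilityMeasure_map hcont.aemeasurable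
  have hpV : IsProbabilityMeasure ((π.prod ν).map fun q => min q.1 (max (q.1 + q.2) 0)) :=
    Measure.isProbabilityMeasure_map hcont2.aemeasurable
  have hq : ∀ᵐ q ∂(π.prod ν), 0 ≤ q.1 := Measure.quasiMeasurePreserving_fst.ae hπ0
  have hWeq : FGMQueue.waiting W0 S A = fun n ω => FGMQueue.lindley (W0 ω) (fun i => X i ω) n := by
    ext n ω; exact FGMQueue.waiting_eq_lindley W0 S A n ω
  have hker : ∀ w, 0 ≤ w → ∀ s : ℂ, 0 ≤ s.re → s ≠ lam → s ≠ 2 * lam →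
      ∫ x, Complex.exp (-s * ((max (w + x) 0 : ℝ) : ℂ)) ∂ν
        = Complex.exp (-s * w) * (1 - FGMQueue.bracket lam θ a p f s)
          + FGMQueue.rhs lam θ a p f (Complex.exp (-lam * w)) (Complex.exp (-(2 * lam) * w)) s := by
    intro w hw s hs h1 h2
    rw [hνdef, integral_map (hXm 0).aemeasurable
      (by fun_prop : Measurable _).aestronglyMeasurable]
    exact FGMQueue.integral_increment_cexp_max hlam hθ' ha hp hfm hf0 (hSm 0) (hJm 0) (hOm 0)
      (hS 0) (hJ 0) (hOmlaw 0) (hSJ 0) (hOmind 0) hw hs h1 h2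
  have hfe : ∀ s : ℂ, 0 ≤ s.re → s ≠ lam → s ≠ 2 * lam →
      FGMQueue.lst π s * FGMQueue.bracket lam θ a p f s =
        FGMQueue.rhs lam θ a p f (FGMQueue.lst π lam) (FGMQueue.lst π (2 * lam)) s := by
    intro s hs h1 h2
    have hl1 : 0 ≤ (lam : ℂ).re := by simpa using hlam.le
    have hl2 : 0 ≤ (2 * (lam : ℂ)).re := by simpa using hlam.le
    have j0 := FGMQueue.integrable_cexp_neg_mul hπ0 hs
    have j1 := FGMQueue.integrable_cexp_neg_mul hπ0 hl1
    have j2 := FGMQueue.integrable_cexp_neg_mul hπ0 hl2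
    have h := FGMQueue.lst_stationary hinv hs
    rw [integral_congr_ae (hπ0.mono fun w hw => hker w hw s hs h1 h2)] at h
    simp only [FGMQueue.rhs_eq hfm hf0] at h ⊢
    rw [integral_add (j0.mul_const _)
      (by exact ((j1.const_mul _).sub (j2.const_mul _)).const_mul _), integral_mul_const,
      integral_const_mul, integral_sub (by exact j1.const_mul _) (by exact j2.const_mul _),
      integral_const_mul, integral_const_mul] at h
    simp only [FGMQueue.lst] at h ⊢
    linear_combination h
  have hM : ∀ s : ℂ, 0 ≤ s.re → s ≠ lam → s ≠ 2 * lam →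
      FGMQueue.lst ((π.prod ν).map fun q => q.1 + max q.2 0) s
        = FGMQueue.lst π s * FGMQueue.maxFactor lam θ a p f s := by
    intro s hs h1 h2
    have h := hker 0 le_rfl s hs h1 h2
    simp only [zero_add, Complex.ofReal_zero, mul_zero, Complex.exp_zero, one_mul] at h
    rw [FGMQueue.lst_max_overlap, h, FGMQueue.one_sub_bracket_add_rhs_one]
  have hz := FGMQueue.zeroForm_of_functional_equation hlam hfm hf0 hES ha hp1 hπ0 hfe
  have hb0 := FGMQueue.bracket_zero (θ := θ) (a := a) (p := p) hfm hf0 hlam hp1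
  have hαlt := FGMQueue.theta_mul_mixG_lt_mixPhi (f := f) hθ' ha hp hp1 hlam.le
  have hGpos := FGMQueue.mixG_pos (f := f) ha hp hp1 (by positivity : 0 < 2 * lam)
  -- `α < 0` always, and `β ≠ 0` when `θ ≠ 0`: these make the equations for the unknowns
  -- nondegenerate.
  have hα : ((θ * FGMQueue.mixG a p f lam - FGMQueue.mixPhi a p f lam : ℝ) : ℂ) ≠ 0 := by
    exact_mod_cast (sub_neg.2 hαlt).ne
  have hβ : θ ≠ 0 → ((θ * FGMQueue.mixG a p f (2 * lam) : ℝ) : ℂ) ≠ 0 := fun h => by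
    exact_mod_cast mul_ne_zero h hGpos.ne'
  have hfe' := hfe
  simp only [FGMQueue.rhs_eq hfm hf0] at hfe'
  have hz' := hz
  rw [FGMQueue.zeroForm_eq hfm hf0] at hz'
  have hTW : TendstoInDistribution (FGMQueue.waiting W0 S A) atTop id (fun _ => P) π := by
    rw [hWeq]
    exact FGMQueue.TendstoInDistribution.continuous_comp_id hD continuous_fst
      (by rw [Measure.map_fst_prod]; simp)
  have hTM : TendstoInDistribution (FGMQueue.maxOverlap W0 S A) atTop id (fun _ => P)
      ((π.prod ν).map fun q => q.1 + max q.2 0) := by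
    have e : FGMQueue.maxOverlap W0 S A = fun n ω =>
        FGMQueue.lindley (W0 ω) (fun i => X i ω) n + max (X n ω) 0 := by
      ext n ω; rw [FGMQueue.maxOverlap, hWeq]
    rw [e]
    exact FGMQueue.TendstoInDistribution.continuous_comp_id hD hcont rfl
  have hTV : TendstoInDistribution (FGMQueue.minOverlap W0 S A) atTop id (fun _ => P)
      ((π.prod ν).map fun q => min q.1 (max (q.1 + q.2) 0)) := by
    have e : FGMQueue.minOverlap W0 S A = fun n ω =>
        min (FGMQueue.lindley (W0 ω) (fun i => X i ω) n)
          (max (FGMQueue.lindley (W0 ω) (fun i => X i ω) n + X n ω) 0) := by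
      ext n ω; rw [FGMQueue.minOverlap, hWeq, add_sub_assoc]
    rw [e]
    exact FGMQueue.TendstoInDistribution.continuous_comp_id hD hcont2 rfl
  refine ⟨⟨π, hπ⟩, ⟨_, hpM⟩, ⟨_, hpV⟩, hTW, hTM, hTV, hπ0, ?_, ?_, hfe, FGMQueue.lst_zero π, hz,
    ?_, ?_, hM, ?_, ?_⟩
  · exact (ae_map_iff hcont.aemeasurable measurableSet_Ici).2
      (hq.mono fun q h => add_nonneg h (le_max_right _ _))
  · exact (ae_map_iff hcont2.aemeasurable measurableSet_Ici).2
      (hq.mono fun q h => le_min h (le_max_right _ _))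
  · intro hθ0
    obtain ⟨t, ht, ht1, ht2, hkt⟩ :=
      FGMQueue.exists_pos_zero_kernelReal (f := f) hlam hθ' hθ0 ha hp hp1
    have htb : FGMQueue.bracket lam θ a p f t = 0 := by
      rw [FGMQueue.bracket_ofReal hfm hf0 ht1 ht2, hkt]; simp
    have n1 : (t : ℂ) ≠ lam := by exact_mod_cast ht1
    have n2 : (t : ℂ) ≠ 2 * lam := by exact_mod_cast ht2
    have n0 : (t : ℂ) ≠ 0 := by exact_mod_cast ht.ne'
    have d1 : (lam : ℂ) - t ≠ 0 := sub_ne_zero.2 n1.symm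
    have d2 : 2 * (lam : ℂ) - t ≠ 0 := sub_ne_zero.2 n2.symm
    have d2' : (lam : ℂ) * 2 - t ≠ 0 := by rwa [mul_comm]
    have hlin : ∀ x y : ℂ, FGMQueue.rhs lam θ a p f x y t = 0 →
        (2 * lam - t) * (((θ * FGMQueue.mixG a p f lam - FGMQueue.mixPhi a p f lam : ℝ) : ℂ) * x)
        - (lam - t) * (((θ * FGMQueue.mixG a p f (2 * lam) : ℝ) : ℂ) * y) = 0 := by
      intro x y h
      rw [FGMQueue.rhs_eq hfm hf0] at h
      have h3 := (mul_eq_zero.1 h).resolve_left n0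
      generalize ((θ * FGMQueue.mixG a p f lam - FGMQueue.mixPhi a p f lam : ℝ) : ℂ) = α at h3 ⊢
      generalize ((θ * FGMQueue.mixG a p f (2 * lam) : ℝ) : ℂ) = β at h3 ⊢
      field_simp at h3
      linear_combination h3
    have htr : FGMQueue.rhs lam θ a p f (FGMQueue.lst π lam) (FGMQueue.lst π (2 * lam)) t = 0 := by
      rw [← hfe t (by simpa using ht.le) n1 n2, htb, mul_zero]
    refine ⟨t, by simpa using ht, n1, n2, fun s hs h1 h2 => ⟨fun h => ?_, ?_⟩, fun x y => ⟨?_, ?_⟩⟩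
    · by_cases hs0 : s = 0
      · exact Or.inr hs0
      · exact Or.inl (FGMQueue.kernel_zeros hlam hstab hfe' hz' hs h1 h2 hs0 h (hlin _ _ htr))
    · rintro (rfl | rfl)
      · exact htb
      · exact hb0
    · rintro ⟨h1, h2⟩
      have h3 := hlin _ _ h2
      have h4 := hlin _ _ htr
      rw [FGMQueue.zeroForm_eq hfm hf0] at h1
      have h5 := hβ hθ0
      generalize ((θ * FGMQueue.mixG a p f lam - FGMQueue.mixPhi a p f lam : ℝ) : ℂ) = α at *
      generalize ((θ * FGMQueue.mixG a p f (2 * lam) : ℝ) : ℂ) = β at *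
      -- Eliminating `y` between the two equations leaves the coefficient `(2λ - t) - 2(λ - t) = t`
      -- on `α` times the difference of the `x`-values.
      have hx : t * (α * (x - FGMQueue.lst π lam)) = 0 := by
        linear_combination h3 - h4 - (lam - t) * (h1 - hz')
      have hx' := (mul_eq_zero.1 ((mul_eq_zero.1 hx).resolve_left n0)).resolve_left hα
      have hy : β * (y - FGMQueue.lst π (2 * lam)) = 0 := by
        linear_combination 2 * α * hx' - (h1 - hz')
      exact ⟨sub_eq_zero.1 hx', sub_eq_zero.1 ((mul_eq_zero.1 hy).resolve_left h5)⟩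
    · rintro ⟨rfl, rfl⟩
      exact ⟨hz, htr⟩
  · intro hθ0
    have hβ0 : ((θ * FGMQueue.mixG a p f (2 * lam) : ℝ) : ℂ) = 0 := by rw [hθ0]; simp
    refine ⟨fun s hs h1 h2 => ⟨fun h => ?_, ?_⟩, fun x y => ?_⟩
    · by_contra hs0
      -- With `β = 0` the affine function is `(2λ - s) α x`, which has the root `2λ`; any nonzero
      -- zero of the kernel would equal this excluded point.
      refine h2 (FGMQueue.kernel_zeros hlam hstab hfe' hz' hs h1 h2 hs0 h ?_)
      rw [hβ0]; ring
    · rintro rfl; exact hb0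
    · show _ ↔ x = FGMQueue.lst π lam
      rw [← hz, FGMQueue.zeroForm_eq hfm hf0, FGMQueue.zeroForm_eq hfm hf0, hβ0]
      constructor
      · intro h
        refine mul_left_cancel₀ (mul_ne_zero two_ne_zero hα) ?_
        linear_combination h
      · rintro rfl; ring
  · intro s hs h1 h2
    show FGMQueue.lst ((π.prod ν).map fun q => min q.1 (max (q.1 + q.2) 0)) s = _
    rw [FGMQueue.lst_min_overlap hπ0 hinv hs, hM s hs h1 h2, FGMQueue.minFactor_eq]
    show _ = FGMQueue.lst π s * _
    ring
  · intro ha0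
    have h1 : ∀ᵐ ω ∂P, ∀ n, 0 ≤ S n ω := ae_all_iff.2 fun n =>
      ae_of_ae_map (p := fun x => 0 ≤ x) (hSm n).aemeasurable (by
        rw [hS n]; exact (FGMQueue.ae_pos_lawOfDensity f).mono fun _ => le_of_lt)
    have h2 : ∀ᵐ ω ∂P, ∀ n, 0 ≤ J n ω := ae_all_iff.2 fun n =>
      ae_of_ae_map (p := fun x => 0 ≤ x) (hJm n).aemeasurable (by
        rw [hJ n]; exact FGMQueue.ae_nonneg_expMeasure lam)
    have h3 : ∀ᵐ ω ∂P, ∀ n, 0 ≤ Om n ω := ae_all_iff.2 fun n =>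
      ae_of_ae_map (p := fun x => 0 ≤ x) (hOm n).aemeasurable (by
        rw [hOmlaw n]; exact FGMQueue.ae_sum_smul_dirac ha0)
    filter_upwards [h1, h2, h3, hW0] with ω g1 g2 g3 g0 n hn
    exact FGMQueue.overlap_extremes g0 g1
      (fun k => add_nonneg (mul_nonneg (g3 k) (g1 k)) (g2 k)) hn
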